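/- **Setting.** Let $\ell\ge 0$, $m\ge 0$ be integers, let $\mathcal H_0\subset\{1,\dots,m\}$ (the nulls) and $\mathcal H_1=\{1,\dots,m\}\setminus\mathcal H_0$. Let $S_{k+1},\dots,S_{n}$ (with $n-k=\ell$; calibration scores) and $S_{n+1},\dots,S_{n+m}$ (test scores) be real random variables on a probability space such that (i) $(S_{k+1},\dots,S_n,\;S_{n+i},\,i\in\mathcal H_0)$ is exchangeable conditionally on $(S_{n+i},\,i\in\mathcal H_1)$, and (ii) almost surely $S_{k+1},\dots,S_{n+m}$ are pairwise distinct. The empirical $p$-values are $$p_j=\frac1{\ell+1}\Big(1+\sum_{i=k+1}^{n}\mathbf 1\{S_i>S_{n+j}\}\Big),\qquad 1\le j\le m .$$ The BH algorithm at level $a$ rejects $R_a=\{i: p_i\le a\hat k/m\}$, where $\hat k=\max\{k\in\{0,\dots,m\}:\ \#\{i:p_i\le a k/m\}\ge k\}$, and the false discovery rate of a rejection set $R$ is $\mathrm{FDR}(R)=\mathbb E\big[|\mathcal H_0\cap R|/(1\vee|R|)\big]$. For $i\in\mathcal H_0$ let $\mathcal D_i$ be the law of the random vector $(p'_1,\dots,p'_m)$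 for which $p'_i=1/(\ell+1)$, $p'_j=0$ for $j\in\mathcal H_1$, and, conditionally on $U=(U_1,\dots,U_{\ell+1})$ with i.i.d. components uniform on $(0,1)$, the $p'_j$, $j\in\mathcal H_0\setminus\{i\}$, are i.i.d. with cumulative distribution function $$F^U(x)=\big(1-U_{(\lfloor x(\ell+1)\rfloor+1)}\big)\mathbf 1\{1/(\ell+1)\le x<1\}+\mathbf 1\{x\ge1\},\qquad U_{(1)}>\dots>U_{(\ell+1)}\text{ the order statistics of }U .$$ **Theorem.** Let $\alpha>0$ and let $G:[0,1]^m\to(0,\infty)$ be any coordinatewise nondecreasing function. Then the BH algorithm at the data-dependent level $\alpha m/G(p)$, applied to the empirical $p$-values $p=(p_1,\dots,p_m)$, satisfies $$\mathrm{FDR}\big(R_{\alpha m/G(p)}\big)\ \le\ \alpha\sum_{i\in\mathcal H_0}\mathbb E_{p'\sim\mathcal D_i}\Big[\frac1{G(p')}\Big].$$ **In particular**, the same bound holds for AdaDetect at level $\alpha m/G(p)$, that is, in the following situation. Let $n=k+\ell$ with $k\ge0$; let $Y_1,\dots,Y_n$ (null training sample, with common marginal law $P_0$) and $X_1,\dots,X_m$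 (test sample) be random elements of a measurable space $\mathcal Z$, put $\mathcal H_0=\{i: X_i\sim P_0\}$ and $(Z_1,\dots,Z_{n+m})=(Y_1,\dots,Y_n,X_1,\dots,X_m)$. Assume that $(Y_1,\dots,Y_n,\;X_i,\,i\in\mathcal H_0)$ is exchangeable conditionally on $(X_i,\,i\in\mathcal H_1)$, and let the scores be $S_i=g\big(Z_i,(Z_1,\dots,Z_k),(Z_{k+1},\dots,Z_{n+m})\big)$, $k+1\le i\le n+m$, where $g$ is a measurable real-valued function invariant under permutations of the entries of its last argument; assume that these scores are almost surely pairwise distinct. -/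

import Mathlib

open MeasureTheory ProbabilityTheory Filter Topology
open scoped unitInterval

namespace AdaDetect

noncomputable section

/-! ### Empirical p-values, the BH algorithm, and the false discovery rate -/

/-- The empirical p-values of `m` test scores with respect to `ℓ` calibration scores. The
calibration scores are `s (Sum.inl a)` and the test scores are `s (Sum.inr j)`. -/
def empPValue {ℓ m : ℕ} (s : Fin ℓ ⊕ Fin m → ℝ) (j : Fin m) : ℝ :=
  (1 + ∑ a : Fin ℓ, if s (Sum.inl a) > s (Sum.inr j) then (1 : ℝ) else 0) / (ℓ + 1)

open Classical in
/-- The number `k̂` of the BH algorithm at level `α`, i.e. the largest `k ∈ {0, …, m}` such that at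
least `k` of the p-values are at most `α k / m`. -/
def bhCount {m : ℕ} (α : ℝ) (p : Fin m → ℝ) : ℕ :=
  Nat.findGreatest (fun k => k ≤ (Finset.univ.filter fun i => p i ≤ α * k / m).card) m

open Classical in
/-- The rejection set of the BH algorithm at level `α`. -/
def bhReject {m : ℕ} (α : ℝ) (p : Fin m → ℝ) : Finset (Fin m) :=
  Finset.univ.filter fun i => p i ≤ α * bhCount α p / m

/-- The rejection set of the BH algorithm at the data-dependent level `α m / G(p)`. -/
def adaptiveBH {m : ℕ} (α : ℝ) (G : (Fin m → ℝ) → ℝ) (p : Fin m → ℝ) : Finset (Fin m) :=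
  bhReject (α * m / G p) p

/-- The false discovery proportion of the rejection set `R` when `H₀` is the set of true nulls. -/
def fdp {m : ℕ} (H₀ R : Finset (Fin m)) : ℝ :=
  (H₀ ∩ R).card / max 1 (R.card : ℝ)

/-- The false discovery rate of the random rejection set `R`. -/
def fdr {Ω : Type*} [MeasurableSpace Ω] (μ : Measure Ω) {m : ℕ} (H₀ : Finset (Fin m))
    (R : Ω → Finset (Fin m)) : ℝ :=
  ∫ ω, fdp H₀ (R ω) ∂μ

/-! ### Conditional exchangeability -/

/-- The family `U` is exchangeable conditionally on the family `V`: for each permutation `τ` of the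
indices, `(U i)ᵢ` and `(U (τ i))ᵢ` have the same conditional probabilities given the σ-field
generated by `V`. -/
def CondExchangeable {Ω E F ι κ : Type*} [MeasurableSpace Ω] [MeasurableSpace E]
    [MeasurableSpace F] (μ : Measure Ω) (U : ι → Ω → E) (V : κ → Ω → F) : Prop :=
  ∀ τ : Equiv.Perm ι, ∀ A : Set (ι → E), MeasurableSet A →
    μ⟦{ω | (fun i => U i ω) ∈ A} |
        MeasurableSpace.comap (fun ω j => V j ω) MeasurableSpace.pi⟧ =ᵐ[μ]
      μ⟦{ω | (fun i => U (τ i) ω) ∈ A} |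
        MeasurableSpace.comap (fun ω j => V j ω) MeasurableSpace.pi⟧

/-- The calibration scores together with the null test scores are exchangeable conditionally on the
non-null test scores. -/
def ScoresExchangeable {Ω : Type*} [MeasurableSpace Ω] (μ : Measure Ω) {ℓ m : ℕ}
    (H₀ : Finset (Fin m)) (S : Fin ℓ ⊕ Fin m → Ω → ℝ) : Prop :=
  CondExchangeable μ
    (Sum.elim (fun a : Fin ℓ => S (Sum.inl a)) (fun i : {i : Fin m // i ∈ H₀} => S (Sum.inr i)))
    (fun j : {j : Fin m // j ∉ H₀} => S (Sum.inr j))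

/-- Almost surely, the scores are pairwise distinct. -/
def NoTies {Ω : Type*} [MeasurableSpace Ω] (μ : Measure Ω) {ι : Type*} (S : ι → Ω → ℝ) : Prop :=
  ∀ᵐ ω ∂μ, Function.Injective fun i => S i ω

/-! ### The AdaDetect scores -/

open Classical in
/-- The set of nulls in the test sample `X`: the indices `i` such that `X i` has law `P₀`. -/
def nulls {Ω 𝒵 : Type*} [MeasurableSpace Ω] [MeasurableSpace 𝒵] (μ : Measure Ω) (P₀ : Measure 𝒵)
    {m : ℕ} (X : Fin m → Ω → 𝒵) : Finset (Fin m) :=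
  Finset.univ.filter fun i => μ.map (X i) = P₀

/-- The null training sample `Y` together with the nulls of the test sample `X` is exchangeable
conditionally on the novelties of the test sample. -/
def DataExchangeable {Ω 𝒵 : Type*} [MeasurableSpace Ω] [MeasurableSpace 𝒵] (μ : Measure Ω)
    {n m : ℕ} (H₀ : Finset (Fin m)) (Y : Fin n → Ω → 𝒵) (X : Fin m → Ω → 𝒵) : Prop :=
  CondExchangeable μ
    (Sum.elim Y (fun i : {i : Fin m // i ∈ H₀} => X i))
    (fun j : {j : Fin m // j ∉ H₀} => X j)

/-- The pooled sample `(Y_{k+1}, …, Y_{k+ℓ}, X_1, …, X_m)`. -/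
def pooled {𝒵 : Type*} {k ℓ m : ℕ} (y : Fin (k + ℓ) → 𝒵) (x : Fin m → 𝒵) : Fin ℓ ⊕ Fin m → 𝒵 :=
  Sum.elim (fun b => y (Fin.natAdd k b)) x

/-- A score function `g (z, (z_1, …, z_k), (z_{k+1}, …, z_{k+ℓ+m}))` is invariant under
permutations of its last `ℓ + m` arguments. -/
def ScoreInvariant {𝒵 : Type*} {k ℓ m : ℕ}
    (g : 𝒵 → (Fin k → 𝒵) → (Fin ℓ ⊕ Fin m → 𝒵) → ℝ) : Prop :=
  ∀ (τ : Equiv.Perm (Fin ℓ ⊕ Fin m)) (z : 𝒵) (a : Fin k → 𝒵) (w : Fin ℓ ⊕ Fin m → 𝒵),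
    g z a (fun i => w (τ i)) = g z a w

/-- The AdaDetect scores: the data-driven score function `g`, evaluated at the points of the pooled
sample. -/
def adaScore {𝒵 : Type*} {k ℓ m : ℕ} (g : 𝒵 → (Fin k → 𝒵) → (Fin ℓ ⊕ Fin m → 𝒵) → ℝ)
    (y : Fin (k + ℓ) → 𝒵) (x : Fin m → 𝒵) (i : Fin ℓ ⊕ Fin m) : ℝ :=
  g (pooled y x i) (fun a => y (Fin.castAdd ℓ a)) (pooled y x)

/-! ### The laws `𝒟ᵢ` -/

/-- The order statistic `u_(b)`, where `u_(1) ≥ u_(2) ≥ … ≥ u_(N)` (and `0` if `b > N`). -/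
def orderStat {N : ℕ} (u : Fin N → I) (b : ℕ) : I :=
  if h : b - 1 < N then u (Tuple.sort (fun i => OrderDual.toDual (u i)) ⟨b - 1, h⟩) else 0

lemma orderStat_anti {N : ℕ} (u : Fin N → I) {b c : ℕ} (h : b ≤ c) :
    orderStat u c ≤ orderStat u b := by
  unfold orderStat
  by_cases hc : c - 1 < N
  · have hb : b - 1 < N := by omega
    rw [dif_pos hc, dif_pos hb]
    have := Tuple.monotone_sort (fun i => OrderDual.toDual (u i))
      (show (⟨b - 1, hb⟩ : Fin N) ≤ ⟨c - 1, hc⟩ by simp [Fin.le_def]; omega)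
    exact this
  · rw [dif_neg hc]
    exact unitInterval.nonneg'

lemma measurable_orderStat {N : ℕ} (b : ℕ) : Measurable fun u : Fin N → I => orderStat u b := by
  unfold orderStat
  by_cases h : b - 1 < N
  · simp only [dif_pos h]
    refine measurable_of_Ici fun c => ?_
    have key : (fun u : Fin N → I => u (Tuple.sort (fun i => OrderDual.toDual (u i)) ⟨b - 1, h⟩))
        ⁻¹' Set.Ici c = {u | b - 1 < ∑ i : Fin N, if c ≤ u i then 1 else 0} := by
      ext u
      set τ := Tuple.sort (fun i => OrderDual.toDual (u i)) with hτ
      have hm : Antitone (u ∘ τ) := fun i j hij =>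
        Tuple.monotone_sort (fun i => OrderDual.toDual (u i)) hij
      have := Tuple.lt_card_ge_iff_apply_ge_of_antitone (a := c) (j := ⟨b - 1, h⟩) hm
      simp only [Set.mem_preimage, Set.mem_Ici, Set.mem_ofPred_eq]
      have e : (∑ i : Fin N, if c ≤ u i then 1 else 0) =
          ∑ i : Fin N, if c ≤ (u ∘ τ) i then 1 else 0 :=
        (Equiv.sum_comp τ fun i => if c ≤ u i then 1 else 0).symm
      rw [e, ← Finset.card_filter]
      simpa [Fintype.card_subtype] using this.symm
    rw [key]
    refine measurableSet_lt measurable_const (Finset.measurable_sum _ fun i _ => ?_)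
    exact Measurable.ite (measurableSet_le measurable_const (measurable_pi_apply i))
      measurable_const measurable_const
  · simp only [dif_neg h]
    exact measurable_const

/-- The function
`F^u(x) = (1 - u_(⌊x(ℓ+1)⌋+1)) 1{1/(ℓ+1) ≤ x < 1} + 1{x ≥ 1}`. -/
def nullCDFFun {ℓ : ℕ} (u : Fin (ℓ + 1) → I) (x : ℝ) : ℝ :=
  if 1 ≤ x then 1
  else if 1 / ((ℓ : ℝ) + 1) ≤ x then 1 - (orderStat u (⌊x * (ℓ + 1)⌋₊ + 1) : ℝ)
  else 0

lemma nullCDFFun_mono {ℓ : ℕ} (u : Fin (ℓ + 1) → I) : Monotone (nullCDFFun u) := by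
  intro x y hxy
  have hI : ∀ b, 0 ≤ (orderStat u b : ℝ) ∧ (orderStat u b : ℝ) ≤ 1 := fun b =>
    ⟨(orderStat u b).2.1, (orderStat u b).2.2⟩
  have hmon : (orderStat u (⌊y * (ℓ + 1)⌋₊ + 1) : ℝ) ≤ orderStat u (⌊x * (ℓ + 1)⌋₊ + 1) := by
    have : ⌊x * ((ℓ : ℝ) + 1)⌋₊ ≤ ⌊y * ((ℓ : ℝ) + 1)⌋₊ :=
      Nat.floor_le_floor (by gcongr)
    exact_mod_cast orderStat_anti u (Nat.succ_le_succ this)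
  have h1 := hI (⌊x * (ℓ + 1)⌋₊ + 1)
  have h2 := hI (⌊y * (ℓ + 1)⌋₊ + 1)
  unfold nullCDFFun
  split_ifs <;> linarith

lemma nullCDFFun_rightCont {ℓ : ℕ} (u : Fin (ℓ + 1) → I) (x : ℝ) :
    ContinuousWithinAt (nullCDFFun u) (Set.Ici x) x := by
  suffices h : ∀ᶠ y in 𝓝[≥] x, nullCDFFun u y = nullCDFFun u x from
    tendsto_const_nhds.congr' (h.mono fun y hy => hy.symm)
  have hge : ∀ᶠ y in 𝓝[≥] x, x ≤ y := self_mem_nhdsWithin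
  have hlt : ∀ c, x < c → ∀ᶠ y in 𝓝[≥] x, y < c := fun c hc =>
    mem_nhdsWithin_of_mem_nhds (Iio_mem_nhds hc)
  have hl : (0 : ℝ) < (ℓ : ℝ) + 1 := by positivity
  have hle : 1 / ((ℓ : ℝ) + 1) ≤ 1 := by
    rw [div_le_one hl]; linarith [(Nat.cast_nonneg ℓ : (0 : ℝ) ≤ ℓ)]
  by_cases h1 : 1 ≤ x
  · filter_upwards [hge] with y hy
    simp [nullCDFFun, h1, h1.trans hy]
  push Not at h1
  by_cases h2 : 1 / ((ℓ : ℝ) + 1) ≤ x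
  · have h0 : 0 ≤ x := le_trans (by positivity) h2
    have h3 : x < ((⌊x * ((ℓ : ℝ) + 1)⌋₊ : ℝ) + 1) / ((ℓ : ℝ) + 1) := by
      rw [lt_div_iff₀ hl]; exact Nat.lt_floor_add_one _
    filter_upwards [hge, hlt 1 h1, hlt _ h3] with y hy hy1 hy3
    rw [lt_div_iff₀ hl] at hy3
    have hfl : ⌊y * ((ℓ : ℝ) + 1)⌋₊ = ⌊x * ((ℓ : ℝ) + 1)⌋₊ := by
      rw [Nat.floor_eq_iff (by have := h0.trans hy; positivity)]
      refine ⟨(Nat.floor_le (by positivity)).trans (by gcongr), hy3⟩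
    simp only [nullCDFFun, not_le.mpr h1, not_le.mpr hy1, h2, h2.trans hy, hfl, if_true, if_false]
  · push Not at h2
    filter_upwards [hlt _ h2] with y hy
    simp only [nullCDFFun, not_le.mpr h1, not_le.mpr (hy.trans_le hle), not_le.mpr h2,
      not_le.mpr hy, if_false]

/-- `F^u`, as a right-continuous nondecreasing function. -/
def nullCDF {ℓ : ℕ} (u : Fin (ℓ + 1) → I) : StieltjesFunction ℝ where
  toFun := nullCDFFun u
  mono' := nullCDFFun_mono u
  right_continuous' := nullCDFFun_rightCont u

lemma nullCDF_tendsto_atBot {ℓ : ℕ} (u : Fin (ℓ + 1) → I) :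
    Tendsto (nullCDF u) atBot (𝓝 0) := by
  refine tendsto_const_nhds.congr' ?_
  filter_upwards [eventually_lt_atBot (0 : ℝ)] with x hx
  have : (0 : ℝ) < 1 / ((ℓ : ℝ) + 1) := by positivity
  change (0 : ℝ) = nullCDFFun u x
  simp only [nullCDFFun, not_le.mpr (hx.trans one_pos), not_le.mpr (hx.trans this), if_false]

lemma nullCDF_tendsto_atTop {ℓ : ℕ} (u : Fin (ℓ + 1) → I) :
    Tendsto (nullCDF u) atTop (𝓝 1) := by
  refine tendsto_const_nhds.congr' ?_
  filter_upwards [eventually_ge_atTop (1 : ℝ)] with x hx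
  change (1 : ℝ) = nullCDFFun u x
  simp [nullCDFFun, hx]

/-- The law on `ℝ` with cumulative distribution function `F^u`. -/
def nullLaw {ℓ : ℕ} (u : Fin (ℓ + 1) → I) : Measure ℝ := (nullCDF u).measure

instance {ℓ : ℕ} (u : Fin (ℓ + 1) → I) : IsProbabilityMeasure (nullLaw u) :=
  (nullCDF u).isProbabilityMeasure (nullCDF_tendsto_atBot u) (nullCDF_tendsto_atTop u)

lemma measurable_nullLaw {ℓ : ℕ} : Measurable (nullLaw (ℓ := ℓ)) := by
  refine Measurable.measure_of_isPiSystem_of_isProbabilityMeasure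
    (borel_eq_generateFrom_Iic ℝ ▸ (BorelSpace.measurable_eq (α := ℝ))) isPiSystem_Iic ?_
  rintro _ ⟨x, rfl⟩
  have : ∀ u : Fin (ℓ + 1) → I, nullLaw u (Set.Iic x) = ENNReal.ofReal (nullCDFFun u x) := by
    intro u
    rw [nullLaw, (nullCDF u).measure_Iic (nullCDF_tendsto_atBot u), sub_zero]
    rfl
  simp only [this]
  refine ENNReal.measurable_ofReal.comp ?_
  unfold nullCDFFun
  split_ifs
  · exact measurable_const
  · exact measurable_const.sub (measurable_subtype_coe.comp (measurable_orderStat _))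
  · exact measurable_const

open Classical in
/-- The conditional law of the coordinate `p'_j` under `𝒟ᵢ` given `U = u`: the point mass at
`1/(ℓ+1)` if `j = i`, the law with c.d.f. `F^u` if `j ∈ H₀ \ {i}`, and the point mass at `0` if
`j ∉ H₀`. -/
def coordLaw {ℓ m : ℕ} (H₀ : Finset (Fin m)) (i : Fin m) (u : Fin (ℓ + 1) → I) (j : Fin m) :
    Measure ℝ :=
  if j = i then Measure.dirac (1 / ((ℓ : ℝ) + 1))
  else if j ∈ H₀ then nullLaw u
  else Measure.dirac 0

instance {ℓ m : ℕ} (H₀ : Finset (Fin m)) (i : Fin m) (u : Fin (ℓ + 1) → I) (j : Fin m) :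
    IsProbabilityMeasure (coordLaw H₀ i u j) := by
  unfold coordLaw
  split_ifs <;> infer_instance

lemma measurable_coordLaw {ℓ m : ℕ} (H₀ : Finset (Fin m)) (i j : Fin m) :
    Measurable fun u : Fin (ℓ + 1) → I => coordLaw H₀ i u j := by
  unfold coordLaw
  split_ifs
  · exact measurable_const
  · exact measurable_nullLaw
  · exact measurable_const

/-- The conditional law of `(p'_1, …, p'_m)` under `𝒟ᵢ` given `U = u`: the coordinates are
conditionally independent. -/
def condLaw (ℓ : ℕ) {m : ℕ} (H₀ : Finset (Fin m)) (i : Fin m) :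
    Kernel (Fin (ℓ + 1) → I) (Fin m → ℝ) where
  toFun u := Measure.pi (coordLaw H₀ i u)
  measurable' := by
    refine Measurable.measure_of_isPiSystem_of_isProbabilityMeasure
      generateFrom_pi.symm isPiSystem_pi ?_
    rintro _ ⟨s, hs, rfl⟩
    simp only [Measure.pi_pi]
    exact Finset.measurable_prod _ fun j _ =>
      (Measure.measurable_coe (show MeasurableSet (s j) from hs j (Set.mem_univ j))).comp (measurable_coordLaw H₀ i j)

/-- The law `𝒟ᵢ` of `(p'_1, …, p'_m)`: the mixture of the conditional laws given `U`, where
`U_1, …, U_{ℓ+1}` are i.i.d. uniform on `[0, 1]`. -/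
def leastFavorable (ℓ : ℕ) {m : ℕ} (H₀ : Finset (Fin m)) (i : Fin m) : Measure (Fin m → ℝ) :=
  (Measure.pi fun _ : Fin (ℓ + 1) => (volume : Measure I)).bind (condLaw ℓ H₀ i)

end

end AdaDetect

/-!
Fix a null `i`. The FDR is the sum over the nulls of `E[1{i ∈ R} / (1 ∨ |R|)]`, and each term is
bounded separately.

The law of the scores is invariant under the permutations of the calibration scores and the null
test scores, hence under the exchange of the test score `i` with any element of the set `W` formed
by the calibration scores and the test score `i` itself. The term of `i` is therefore the
expectation of its average over the `ℓ + 1` exchanges. With `W` and the other test scores held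
fixed, every p-value is nondecreasing in the rank in `W` of the score put at `i`, so the level
`α m / G(p)` and the rejection set shrink as that rank grows. Let `r` be the largest rank at which
`i` is rejected, and `R` the rejection set there. At most `r` terms of the average are nonzero, each
is at most `1 / |R|`, and `r / (ℓ + 1) ≤ α |R| / G(p)` by the definition of the algorithm. So the
average is at most `α / G(p) ≤ α / G(q)`, where `q` is a lower bound of all these p-values: the
coordinate `i` is `1 / (ℓ + 1)`, that of another null is its number of exceedances in `W`,
truncated below at `1`, over `ℓ + 1`, and the non-null ones are `0`
(`sum_fdpTerm_swapScore_le`, `fdr_le_of_map_eq`).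

The vector `q` depends only on the order pattern of the calibration and null test scores, whose law
is the same for all exchangeable families without ties (`integral_comp_orderRel_eq`). For
i.i.d. uniform scores, the law of `q` is `𝒟ᵢ` (`leastFavorable_eq_map`).

For the AdaDetect scores, permuting the calibration and null test observations permutes the scores
in the same way, by the invariance of the score function (`adaScore_samplePerm`), so that the law of
the scores is again invariant.

The function `G` need not be measurable. All the quantities involved are functions of order
patterns, which form a finite discrete measurable space, so this causes no difficulty.
-/

namespace AdaDetect

/-! ### The order pattern of a family -/

/-- The order pattern of the family `s`: the strict comparison relation between its entries. The
type of relations on a finite index type is a finite discrete measurable space. -/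
def orderRel {ι L : Type*} [LT L] (s : ι → L) : ι → ι → Prop := fun a b => s a < s b

lemma measurable_orderRel {ι L : Type*} [Countable ι] [LinearOrder L] [TopologicalSpace L]
    [OrderClosedTopology L] [SecondCountableTopology L] [MeasurableSpace L]
    [OpensMeasurableSpace L] : Measurable (orderRel : (ι → L) → ι → ι → Prop) :=
  measurable_pi_lambda _ fun a => measurable_pi_lambda _ fun b =>
    measurableSet_setOfPred.1 (measurableSet_lt (measurable_pi_apply a) (measurable_pi_apply b))

lemma integrable_comp_orderRel {ι L : Type*} [Finite ι] [LinearOrder L] [TopologicalSpace L]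
    [OrderClosedTopology L] [SecondCountableTopology L] [MeasurableSpace L]
    [OpensMeasurableSpace L] (ν : Measure (ι → L)) [IsFiniteMeasure ν]
    (h : (ι → ι → Prop) → ℝ) : Integrable (fun s => h (orderRel s)) ν := by
  have : Integrable h (ν.map orderRel) := Integrable.of_finite
  exact this.comp_measurable measurable_orderRel

/-- Sorting: all families without ties have the same order pattern up to a permutation. -/
lemma exists_perm_orderRel_eq {ι L : Type*} [Fintype ι] [LinearOrder L] {s : ι → L}
    (hs : Function.Injective s) {n : ℕ} (e : ι ≃ Fin n) :
    ∃ ρ : Equiv.Perm ι, orderRel (s ∘ ρ) = orderRel e := by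
  refine ⟨(e.trans (Tuple.sort (s ∘ e.symm))).trans e.symm, ?_⟩
  have hmono : StrictMono ((s ∘ e.symm) ∘ Tuple.sort (s ∘ e.symm)) :=
    (Tuple.monotone_sort (s ∘ e.symm)).strictMono_of_injective
      ((hs.comp e.symm.injective).comp (Equiv.injective _))
  funext a b
  exact propext (hmono.lt_iff_lt (a := e a) (b := e b))

/-- The expectation of a function of the order pattern of an exchangeable family without ties is
the average of that function over all the strict orderings of the index type. -/
lemma integral_comp_orderRel_eq_average {ι L : Type*} [Fintype ι] [DecidableEq ι] [LinearOrder L]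
    [TopologicalSpace L] [OrderClosedTopology L] [SecondCountableTopology L] [MeasurableSpace L]
    [OpensMeasurableSpace L] (ν : Measure (ι → L)) [IsProbabilityMeasure ν]
    (hinv : ∀ τ : Equiv.Perm ι, ν.map (fun s => s ∘ τ) = ν)
    (hinj : ∀ᵐ s ∂ν, Function.Injective s) {n : ℕ} (e : ι ≃ Fin n) (h : (ι → ι → Prop) → ℝ) :
    ∫ s, h (orderRel s) ∂ν =
      (Fintype.card (Equiv.Perm ι) : ℝ)⁻¹ * ∑ τ : Equiv.Perm ι, h (orderRel (e ∘ τ)) := by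
  have hm : ∀ τ : Equiv.Perm ι, Measurable fun s : ι → L => s ∘ τ := fun τ =>
    measurable_pi_lambda _ fun a => measurable_pi_apply (τ a)
  have hmh : Measurable fun s : ι → L => h (orderRel s) :=
    (measurable_of_finite h).comp measurable_orderRel
  have h1 : ∀ τ : Equiv.Perm ι, ∫ s, h (orderRel (s ∘ τ)) ∂ν = ∫ s, h (orderRel s) ∂ν := by
    intro τ
    conv_rhs => rw [← hinv τ]
    rw [integral_map (hm τ).aemeasurable hmh.aestronglyMeasurable]
  have h2 : ∀ᵐ s ∂ν, ∑ τ : Equiv.Perm ι, h (orderRel (s ∘ τ)) =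
      ∑ τ : Equiv.Perm ι, h (orderRel (e ∘ τ)) := by
    filter_upwards [hinj] with s hs
    obtain ⟨ρ, hρ⟩ := exists_perm_orderRel_eq hs e
    rw [← Equiv.sum_comp (Equiv.mulLeft ρ)]
    refine Finset.sum_congr rfl fun τ _ => congrArg h ?_
    funext a b
    exact congrFun (congrFun hρ (τ a)) (τ b)
  have h3 : ∫ s, ∑ τ : Equiv.Perm ι, h (orderRel (s ∘ τ)) ∂ν =
      Fintype.card (Equiv.Perm ι) * ∫ s, h (orderRel s) ∂ν := by
    rw [integral_finsetSum]
    · simp [h1]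
    · intro τ _
      refine Integrable.comp_measurable (f := fun s : ι → L => s ∘ τ)
        (g := fun s => h (orderRel s)) ?_ (hm τ)
      rw [hinv τ]
      exact integrable_comp_orderRel ν h
  rw [integral_congr_ae h2] at h3
  simp only [integral_const, probReal_univ, one_smul] at h3
  rw [h3, inv_mul_cancel_left₀]
  exact_mod_cast Fintype.card_ne_zero

/-- The order patterns of two exchangeable families without ties have the same law. -/
lemma integral_comp_orderRel_eq {ι L L' : Type*} [Fintype ι]
    [LinearOrder L] [TopologicalSpace L] [OrderClosedTopology L] [SecondCountableTopology L]
    [MeasurableSpace L] [OpensMeasurableSpace L]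
    [LinearOrder L'] [TopologicalSpace L'] [OrderClosedTopology L'] [SecondCountableTopology L']
    [MeasurableSpace L'] [OpensMeasurableSpace L']
    (ν : Measure (ι → L)) [IsProbabilityMeasure ν] (ν' : Measure (ι → L')) [IsProbabilityMeasure ν']
    (hinv : ∀ τ : Equiv.Perm ι, ν.map (fun s => s ∘ τ) = ν)
    (hinj : ∀ᵐ s ∂ν, Function.Injective s)
    (hinv' : ∀ τ : Equiv.Perm ι, ν'.map (fun s => s ∘ τ) = ν')
    (hinj' : ∀ᵐ s ∂ν', Function.Injective s) (h : (ι → ι → Prop) → ℝ) :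
    ∫ s, h (orderRel s) ∂ν = ∫ s, h (orderRel s) ∂ν' := by
  classical
  rw [integral_comp_orderRel_eq_average ν hinv hinj (Fintype.equivFin ι),
    integral_comp_orderRel_eq_average ν' hinv' hinj' (Fintype.equivFin ι)]

lemma measurableSet_injective {ι E : Type*} [Countable ι] [MeasurableSpace E] [MeasurableEq E] :
    MeasurableSet {s : ι → E | Function.Injective s} := by
  have : {s : ι → E | Function.Injective s} = ⋂ a : ι, ⋂ b : ι, {s | s a = s b → a = b} := by
    ext s
    simp [Function.Injective]
  rw [this]
  refine MeasurableSet.iInter fun a => MeasurableSet.iInter fun b => ?_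
  by_cases hab : a = b
  · simp [hab]
  · simp only [hab, imp_false]
    exact (measurableSet_eq_fun (measurable_pi_apply a) (measurable_pi_apply b)).compl

/-! ### Independent and identically distributed families -/

/-- A family extracted from an i.i.d. family without repetition is i.i.d. with the same
marginals. -/
lemma map_comp_pi_of_injective {ι κ E : Type*} [Fintype ι] [Fintype κ] [MeasurableSpace E]
    (P : Measure E) [IsProbabilityMeasure P] {e : κ → ι} (he : Function.Injective e) :
    (Measure.pi fun _ : ι => P).map (fun x => x ∘ e) = Measure.pi fun _ : κ => P := by
  have h : iIndepFun (fun (i : ι) (x : ι → E) => x i) (Measure.pi fun _ : ι => P) :=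
    iIndepFun_pi (X := fun _ => id) fun _ => aemeasurable_id
  have h' := (iIndepFun_iff_map_fun_eq_pi_map
    (fun k => (measurable_pi_apply (e k)).aemeasurable)).1 (h.precomp he)
  refine h'.trans ?_
  congr 1
  funext k
  exact (measurePreserving_eval (fun _ : ι => P) (e k)).map_eq

lemma ae_injective_pi {ι E : Type*} [Fintype ι] [MeasurableSpace E] [MeasurableSingletonClass E]
    [MeasurableEq E] (P : Measure E) [IsProbabilityMeasure P] [NullSingletonClass P] :
    ∀ᵐ x ∂(Measure.pi fun _ : ι => P), Function.Injective x := by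
  have hpair : ∀ a b : ι, a ≠ b → ∀ᵐ x ∂(Measure.pi fun _ : ι => P), x a ≠ x b := by
    intro a b hab
    have h : iIndepFun (fun (i : ι) (x : ι → E) => x i) (Measure.pi fun _ : ι => P) :=
      iIndepFun_pi (X := fun _ => id) fun _ => aemeasurable_id
    have h' := (indepFun_iff_map_prod_eq_prod_map_map (measurable_pi_apply a).aemeasurable
      (measurable_pi_apply b).aemeasurable).1 (h.indepFun hab)
    rw [(measurePreserving_eval (fun _ : ι => P) a).map_eq,
      (measurePreserving_eval (fun _ : ι => P) b).map_eq] at h'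
    have hd : ∀ᵐ z ∂(P.prod P), z ∈ (Set.diagonal E)ᶜ := by
      refine (Measure.ae_prod_iff_ae_ae (p := fun z => z ∈ (Set.diagonal E)ᶜ)
        measurableSet_diagonal.compl).2 (Eventually.of_forall fun x => ?_)
      have := measure_singleton (μ := P) x
      filter_upwards [measure_eq_zero_iff_ae_notMem.1 this] with y hy h
      exact hy h.symm
    rw [← h'] at hd
    exact ae_of_ae_map ((measurable_pi_apply a).prodMk (measurable_pi_apply b)).aemeasurable hd
  have : ∀ᵐ x ∂(Measure.pi fun _ : ι => P), ∀ a b : ι, a ≠ b → x a ≠ x b := by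
    rw [ae_all_iff]; intro a
    rw [ae_all_iff]; intro b
    by_cases hab : a = b
    · simp [hab]
    · filter_upwards [hpair a b hab] with x hx _ using hx
  filter_upwards [this] with x hx a b hab
  by_contra hne
  exact hx a b hne hab

/-! ### Monotonicity of the BH algorithm -/

lemma bhCount_anti {m : ℕ} {a b : ℝ} (hab : a ≤ b) {p q : Fin m → ℝ} (hpq : p ≤ q) :
    bhCount a q ≤ bhCount b p := by
  classical
  unfold bhCount
  refine Nat.findGreatest_mono_left (fun k hk => hk.trans (Finset.card_le_card ?_)) m
  refine Finset.monotone_filter_right _ fun i _ hi => (hpq i).trans (hi.trans ?_)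
  gcongr

lemma bhReject_anti {m : ℕ} {a b : ℝ} (hb : 0 ≤ b) (hab : a ≤ b) {p q : Fin m → ℝ} (hpq : p ≤ q) :
    bhReject a q ⊆ bhReject b p := by
  classical
  refine Finset.monotone_filter_right _ fun i _ hi => (hpq i).trans (hi.trans ?_)
  have : (bhCount a q : ℝ) ≤ bhCount b p := by exact_mod_cast bhCount_anti hab hpq
  gcongr

lemma bhCount_le_card_bhReject {m : ℕ} (a : ℝ) (p : Fin m → ℝ) :
    bhCount a p ≤ (bhReject a p).card :=
  Nat.findGreatest_spec (P := fun k => k ≤ (Finset.univ.filter fun i => p i ≤ a * k / m).card)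
    (Nat.zero_le m) (Nat.zero_le _)

lemma le_of_mem_bhReject {m : ℕ} {a : ℝ} (ha : 0 ≤ a) {p : Fin m → ℝ} {i : Fin m}
    (hi : i ∈ bhReject a p) : p i ≤ a * (bhReject a p).card / m := by
  have hi' : p i ≤ a * bhCount a p / m := (Finset.mem_filter.1 hi).2
  have : (bhCount a p : ℝ) ≤ (bhReject a p).card := by
    exact_mod_cast bhCount_le_card_bhReject a p
  exact hi'.trans (by gcongr)

section

variable {m : ℕ} {α : ℝ} {G : (Fin m → ℝ) → ℝ}

lemma adaptiveBH_anti (hα : 0 < α) (hG_pos : ∀ x ∈ Set.Icc (0 : Fin m → ℝ) 1, 0 < G x)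
    (hG_mono : MonotoneOn G (Set.Icc 0 1)) {p q : Fin m → ℝ} (hp : p ∈ Set.Icc 0 1)
    (hq : q ∈ Set.Icc 0 1) (hpq : p ≤ q) : adaptiveBH α G q ⊆ adaptiveBH α G p := by
  have hGp := hG_pos p hp
  have hG := hG_mono hp hq hpq
  refine bhReject_anti (by positivity) ?_ hpq
  gcongr

lemma le_of_mem_adaptiveBH (hα : 0 < α) {p : Fin m → ℝ} (hGp : 0 < G p) {i : Fin m}
    (hi : i ∈ adaptiveBH α G p) : p i ≤ α * (adaptiveBH α G p).card / G p := by
  have h := le_of_mem_bhReject (by positivity) hi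
  have hm : (m : ℝ) ≠ 0 := by
    have := i.pos
    positivity
  refine h.trans (le_of_eq ?_)
  unfold adaptiveBH
  field_simp

end

/-- The contribution of the index `i` to the false discovery proportion of `R`. -/
noncomputable def fdpTerm {m : ℕ} (i : Fin m) (R : Finset (Fin m)) : ℝ :=
  if i ∈ R then 1 / max 1 (R.card : ℝ) else 0

lemma fdp_eq_sum {m : ℕ} (H₀ R : Finset (Fin m)) : fdp H₀ R = ∑ i ∈ H₀, fdpTerm i R := by
  unfold fdp fdpTerm
  rw [← Finset.sum_filter, Finset.sum_const, Finset.filter_mem_eq_inter, nsmul_eq_mul]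
  ring

/-! ### Exchanging a null test score with a calibration score -/

/-- The positions of the calibration scores and of the test score `i`: the latter has
index `0`, the calibration score `a` has index `a.succ`. -/
def calIndex {ℓ : ℕ} {T : Type*} (i : T) : Fin (ℓ + 1) → Fin ℓ ⊕ T :=
  Fin.cons (Sum.inr i) Sum.inl

lemma calIndex_injective {ℓ : ℕ} {T : Type*} (i : T) :
    Function.Injective (calIndex (ℓ := ℓ) i) := by
  refine Fin.cons_injective_iff.2 ⟨by simp, Sum.inl_injective⟩

/-- The number of elements of the family `u` exceeding `x`. -/
noncomputable def countGT {N : ℕ} {L : Type*} [LinearOrder L] (u : Fin N → L) (x : L) : ℕ :=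
  (Finset.univ.filter fun w => x < u w).card

lemma countGT_anti {N : ℕ} {L : Type*} [LinearOrder L] (u : Fin N → L) : Antitone (countGT u) :=
  fun _ _ hxy => Finset.card_le_card <| Finset.monotone_filter_right _ fun _ _ h => hxy.trans_lt h

lemma countGT_le {N : ℕ} {L : Type*} [LinearOrder L] (u : Fin N → L) (x : L) :
    countGT u x ≤ N :=
  (Finset.card_filter_le _ _).trans (by simp)

section

variable {ℓ m : ℕ}

/-- The family of scores in which the test score `i` and the score at the position
`calIndex i w` trade places. -/
def swapScore (i : Fin m) (w : Fin (ℓ + 1)) (s : Fin ℓ ⊕ Fin m → ℝ) : Fin ℓ ⊕ Fin m → ℝ :=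
  s ∘ Equiv.swap (calIndex i w) (calIndex i 0)

lemma swapScore_self (i : Fin m) (w : Fin (ℓ + 1)) (s : Fin ℓ ⊕ Fin m → ℝ) :
    swapScore i w s (Sum.inr i) = s (calIndex i w) := by
  change s (Equiv.swap (calIndex i w) (calIndex i 0) (calIndex i 0)) = _
  rw [Equiv.swap_apply_right]

lemma swapScore_of_ne {i j : Fin m} (hj : j ≠ i) (w : Fin (ℓ + 1)) (s : Fin ℓ ⊕ Fin m → ℝ) :
    swapScore i w s (Sum.inr j) = s (Sum.inr j) := by
  refine congrArg s (Equiv.swap_apply_of_ne_of_ne ?_ ?_)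
  · refine Fin.cases ?_ (fun a => ?_) w
    · simpa [calIndex] using hj
    · simp [calIndex]
  · simpa [calIndex] using hj

/-- The p-values after an exchange, in terms of the number of exceedances among the fixed set of
scores that can be put at `i`: the score that is put there does not count as an exceedance. -/
lemma empPValue_swapScore (i j : Fin m) (w : Fin (ℓ + 1)) (s : Fin ℓ ⊕ Fin m → ℝ) :
    empPValue (swapScore i w s) j =
      (1 + (countGT (s ∘ calIndex i) (swapScore i w s (Sum.inr j)) : ℝ) -
        if swapScore i w s (Sum.inr j) < s (calIndex i w) then 1 else 0) / (ℓ + 1) := by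
  set x := swapScore i w s (Sum.inr j) with hx
  have hperm : ∀ v, swapScore i w s (calIndex i v) = s (calIndex i (Equiv.swap w 0 v)) := by
    intro v
    refine congrArg s ?_
    exact (calIndex_injective i).swap_apply w 0 v
  have hsum : (countGT (s ∘ calIndex i) x : ℝ) =
      ∑ v, if x < swapScore i w s (calIndex i v) then (1 : ℝ) else 0 := by
    simp only [hperm]
    rw [Equiv.sum_comp (Equiv.swap w 0) fun v => if x < s (calIndex i v) then (1 : ℝ) else 0]
    simp [countGT]
  rw [hsum, Fin.sum_univ_succ, hperm, Equiv.swap_apply_right]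
  unfold empPValue
  simp only [calIndex, Fin.cons_succ, gt_iff_lt, ← hx]
  ring_nf

lemma empPValue_mem_Icc (s : Fin ℓ ⊕ Fin m → ℝ) : empPValue s ∈ Set.Icc (0 : Fin m → ℝ) 1 := by
  have hle : ∀ j, (∑ a : Fin ℓ, if s (Sum.inl a) > s (Sum.inr j) then (1 : ℝ) else 0) ≤ ℓ := by
    intro j
    calc _ ≤ ∑ a : Fin ℓ, (1 : ℝ) := Finset.sum_le_sum fun a _ => by split_ifs <;> norm_num
      _ = ℓ := by simp
  refine ⟨fun j => ?_, fun j => ?_⟩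
  · unfold empPValue
    simp only [Pi.zero_apply]
    positivity
  · unfold empPValue
    rw [Pi.one_apply, div_le_one (by positivity)]
    linarith [hle j]

/-- The p-values are nonincreasing in the score put at the position `i`. -/
lemma empPValue_swapScore_anti (i : Fin m) {w w' : Fin (ℓ + 1)} {s : Fin ℓ ⊕ Fin m → ℝ}
    (h : s (calIndex i w) ≤ s (calIndex i w')) :
    empPValue (swapScore i w' s) ≤ empPValue (swapScore i w s) := by
  intro j
  rw [empPValue_swapScore, empPValue_swapScore]
  have hl : (0 : ℝ) < (ℓ : ℝ) + 1 := by positivity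
  refine div_le_div_of_nonneg_right ?_ hl.le
  by_cases hj : j = i
  · subst hj
    simp only [swapScore_self, lt_irrefl, if_false, sub_zero]
    have := countGT_anti (s ∘ calIndex j) h
    gcongr
  · simp only [swapScore_of_ne hj]
    have : (if s (Sum.inr j) < s (calIndex i w) then (1 : ℝ) else 0) ≤
        if s (Sum.inr j) < s (calIndex i w') then (1 : ℝ) else 0 := by
      split_ifs with h1 h2
      · exact le_rfl
      · exact absurd (h1.trans_le h) h2
      · exact zero_le_one
      · exact le_rfl
    linarith

open Classical in
/-- The smallest configuration of the p-values when the calibration scores and the null test score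
`i` are permuted, with the non-null p-values replaced by `0`: the null test score `j ≠ i` has
p-value `max(1, C_j) / (ℓ + 1)`, where `C_j` is the number of exceedances of `j` among the
calibration scores and the test score `i`. As a function of the order pattern `r` of the
calibration and null test scores. -/
noncomputable def minPValue (H₀ : Finset (Fin m)) (i : {i : Fin m // i ∈ H₀})
    (r : Fin ℓ ⊕ {i : Fin m // i ∈ H₀} → Fin ℓ ⊕ {i : Fin m // i ∈ H₀} → Prop) (j : Fin m) : ℝ :=
  if j = i then 1 / ((ℓ : ℝ) + 1)
  else if h : j ∈ H₀ then
    (max 1 (Finset.univ.filter fun w => r (Sum.inr ⟨j, h⟩) (calIndex i w)).card : ℕ) / ((ℓ : ℝ) + 1)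
  else 0

/-- The position of the calibration and null test scores among all the scores. -/
def nullIndex (A : Type*) (H₀ : Finset (Fin m)) : A ⊕ {i : Fin m // i ∈ H₀} ↪ A ⊕ Fin m :=
  (Function.Embedding.refl A).sumMap (Function.Embedding.subtype _)

lemma nullIndex_calIndex (H₀ : Finset (Fin m)) (i : {i : Fin m // i ∈ H₀}) (w : Fin (ℓ + 1)) :
    nullIndex (Fin ℓ) H₀ (calIndex i w) = calIndex (i : Fin m) w := by
  refine Fin.cases ?_ (fun a => ?_) w <;> rfl

lemma minPValue_orderRel {L : Type*} [LinearOrder L] (H₀ : Finset (Fin m))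
    (i : {i : Fin m // i ∈ H₀}) (s : Fin ℓ ⊕ {i : Fin m // i ∈ H₀} → L) {j : Fin m}
    (hj : j ≠ i) (h : j ∈ H₀) : minPValue H₀ i (orderRel s) j =
      (max 1 (countGT (s ∘ calIndex i) (s (Sum.inr ⟨j, h⟩))) : ℕ) / ((ℓ : ℝ) + 1) := by
  rw [minPValue, if_neg hj, dif_pos h]
  simp only [countGT, orderRel, Function.comp_apply]
  congr

/-- The vector `minPValue` is a lower bound of the p-values, whichever score is put at `i`. -/
lemma minPValue_le (H₀ : Finset (Fin m)) (i : {i : Fin m // i ∈ H₀}) (w : Fin (ℓ + 1))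
    (s : Fin ℓ ⊕ Fin m → ℝ) :
    minPValue H₀ i (orderRel (s ∘ nullIndex (Fin ℓ) H₀)) ≤ empPValue (swapScore i w s) := by
  intro j
  have hl : (0 : ℝ) < (ℓ : ℝ) + 1 := by positivity
  by_cases hj : j = i
  · subst hj
    rw [minPValue, if_pos rfl, empPValue_swapScore]
    simp only [swapScore_self, lt_irrefl, if_false, sub_zero]
    have := (countGT (s ∘ calIndex (i : Fin m)) (s (calIndex (i : Fin m) w))).cast_nonneg (α := ℝ)
    gcongr
    linarith
  by_cases h : j ∈ H₀
  · rw [minPValue_orderRel H₀ i _ hj h, empPValue_swapScore, swapScore_of_ne hj]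
    refine div_le_div_of_nonneg_right ?_ hl.le
    have hcomp : (s ∘ nullIndex (Fin ℓ) H₀) ∘ calIndex i = s ∘ calIndex (i : Fin m) := by
      funext v
      exact congrArg s (nullIndex_calIndex H₀ i v)
    rw [hcomp]
    change ((max 1 (countGT (s ∘ calIndex (i : Fin m)) (s (Sum.inr j))) : ℕ) : ℝ) ≤ _
    push_cast
    split_ifs with hlt
    · -- The score at position `calIndex i w` is itself one of the exceedances.
      have : 1 ≤ countGT (s ∘ calIndex (i : Fin m)) (s (Sum.inr j)) :=
        Finset.card_pos.2 ⟨w, by simpa using hlt⟩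
      have : (1 : ℝ) ≤ countGT (s ∘ calIndex (i : Fin m)) (s (Sum.inr j)) := by exact_mod_cast this
      rw [max_eq_right this]
      linarith
    · have := (countGT (s ∘ calIndex (i : Fin m)) (s (Sum.inr j))).cast_nonneg (α := ℝ)
      refine max_le ?_ ?_ <;> linarith
  · rw [minPValue, if_neg hj, dif_neg h]
    exact (empPValue_mem_Icc _).1 j

lemma minPValue_mem_Icc (H₀ : Finset (Fin m)) (i : {i : Fin m // i ∈ H₀})
    (r : Fin ℓ ⊕ {i : Fin m // i ∈ H₀} → Fin ℓ ⊕ {i : Fin m // i ∈ H₀} → Prop) :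
    minPValue H₀ i r ∈ Set.Icc (0 : Fin m → ℝ) 1 := by
  have hl : (0 : ℝ) < (ℓ : ℝ) + 1 := by positivity
  classical
  have hl1 : 1 / ((ℓ : ℝ) + 1) ≤ 1 := by
    rw [div_le_one hl]; linarith [(Nat.cast_nonneg ℓ : (0 : ℝ) ≤ ℓ)]
  refine ⟨fun j => ?_, fun j => ?_⟩
  · simp only [minPValue, Pi.zero_apply]
    split_ifs <;> positivity
  · simp only [minPValue, Pi.one_apply]
    split_ifs
    · exact hl1
    · rw [div_le_one hl]
      refine le_trans (Nat.cast_le.2 (max_le (show 1 ≤ ℓ + 1 by omega)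
        ((Finset.card_filter_le _ _).trans ?_))) (by push_cast; exact le_rfl)
      rw [Finset.card_univ, Fintype.card_fin]
    · exact zero_le_one

/-- Averaging over the exchanges of the test score `i` with the calibration scores. The key is that
the p-values are nondecreasing in the rank of the score put at `i`, so that the rejection set
shrinks; the largest rank for which `i` is rejected bounds the number of terms, and the size of the
rejection set there bounds each of them. -/
lemma sum_fdpTerm_swapScore_le {α : ℝ} (hα : 0 < α) {G : (Fin m → ℝ) → ℝ}
    (hG_pos : ∀ x ∈ Set.Icc (0 : Fin m → ℝ) 1, 0 < G x)
    (hG_mono : MonotoneOn G (Set.Icc 0 1)) (H₀ : Finset (Fin m)) (i : {i : Fin m // i ∈ H₀})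
    {s : Fin ℓ ⊕ Fin m → ℝ} (hs : Function.Injective s) :
    ∑ w : Fin (ℓ + 1), fdpTerm i (adaptiveBH α G (empPValue (swapScore i w s))) ≤
      (ℓ + 1) * (α * (1 / G (minPValue H₀ i (orderRel (s ∘ nullIndex (Fin ℓ) H₀))))) := by
  classical
  set q := minPValue H₀ i (orderRel (s ∘ nullIndex (Fin ℓ) H₀))
  have hl : (0 : ℝ) < (ℓ : ℝ) + 1 := by positivity
  have hGq : 0 < G q := hG_pos q (minPValue_mem_Icc H₀ i _)
  set R : Fin (ℓ + 1) → Finset (Fin m) :=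
    fun w => adaptiveBH α G (empPValue (swapScore i w s)) with hR
  set D := Finset.univ.filter fun w => (i : Fin m) ∈ R w with hD
  have hsum : ∑ w, fdpTerm i (R w) = ∑ w ∈ D, 1 / max 1 ((R w).card : ℝ) := by
    rw [hD, Finset.sum_filter]
    rfl
  rw [hsum]
  rcases D.eq_empty_or_nonempty with hDe | hDne
  · rw [hDe, Finset.sum_empty]
    positivity
  obtain ⟨w₀, hw₀, hmin⟩ := D.exists_min_image (fun w => s (calIndex i w)) hDne
  have hmem : (i : Fin m) ∈ R w₀ := (Finset.mem_filter.1 hw₀).2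
  have hcard : (0 : ℝ) < (R w₀).card := by exact_mod_cast Finset.card_pos.2 ⟨_, hmem⟩
  have hterm : ∀ w ∈ D, 1 / max 1 ((R w).card : ℝ) ≤ 1 / (R w₀).card := by
    intro w hw
    refine one_div_le_one_div_of_le hcard (le_max_of_le_right ?_)
    exact_mod_cast Finset.card_le_card (adaptiveBH_anti hα hG_pos hG_mono (empPValue_mem_Icc _)
      (empPValue_mem_Icc _) (empPValue_swapScore_anti (i : Fin m) (hmin w hw)))
  -- By injectivity of `s`, the elements of `D` other than `w₀` are exceedances of `w₀`.
  have hDcard : (D.card : ℝ) ≤ (ℓ + 1) * empPValue (swapScore i w₀ s) i := by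
    rw [empPValue_swapScore, swapScore_self, if_neg (lt_irrefl _), sub_zero,
      mul_div_cancel₀ _ hl.ne']
    have : D ⊆ insert w₀ (Finset.univ.filter fun w =>
        s (calIndex (i : Fin m) w₀) < (s ∘ calIndex (i : Fin m)) w) := by
      intro w hw
      rcases (hmin w hw).lt_or_eq with h | h
      · exact Finset.mem_insert_of_mem (by simpa using h)
      · rw [calIndex_injective (i : Fin m) (hs h)]
        exact Finset.mem_insert_self _ _
    have h2 := (Finset.card_le_card this).trans (Finset.card_insert_le _ _)
    have h3 : D.card ≤ 1 + countGT (s ∘ calIndex (i : Fin m)) (s (calIndex (i : Fin m) w₀)) :=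
      h2.trans (Nat.add_comm _ _).le
    exact_mod_cast h3
  have hp := le_of_mem_adaptiveBH hα (hG_pos _ (empPValue_mem_Icc _)) hmem
  have hGle : G q ≤ G (empPValue (swapScore i w₀ s)) :=
    hG_mono (minPValue_mem_Icc H₀ i _) (empPValue_mem_Icc _) (minPValue_le H₀ i w₀ s)
  calc ∑ w ∈ D, 1 / max 1 ((R w).card : ℝ) ≤ ∑ w ∈ D, 1 / ((R w₀).card : ℝ) :=
        Finset.sum_le_sum hterm
    _ = D.card / (R w₀).card := by rw [Finset.sum_const, nsmul_eq_mul, mul_one_div]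
    _ ≤ ((ℓ + 1) * (α * (R w₀).card / G q)) / (R w₀).card := by
        gcongr
        refine hDcard.trans ?_
        gcongr
        exact hp.trans (by gcongr)
    _ = (ℓ + 1) * (α * (1 / G q)) := by field_simp

end

/-! ### The law of the smallest p-values -/

lemma lt_orderStat_iff {N : ℕ} (u : Fin N → I) {b : ℕ} (hb : b < N) (v : I) :
    v < orderStat u (b + 1) ↔ b < countGT u v := by
  set τ := Tuple.sort (fun k => OrderDual.toDual (u k)) with hτ
  have hanti : ∀ {j k : Fin N}, j ≤ k → u (τ k) ≤ u (τ j) := fun {j k} hjk =>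
    Tuple.monotone_sort (fun k => OrderDual.toDual (u k)) hjk
  have hstat : orderStat u (b + 1) = u (τ ⟨b, hb⟩) := dif_pos hb
  have hcount : countGT u v = (Finset.univ.filter fun k => v < u (τ k)).card := by
    rw [countGT, Finset.card_filter, Finset.card_filter]
    exact (Equiv.sum_comp τ fun k => if v < u k then 1 else 0).symm
  rw [hstat, hcount]
  constructor
  · intro h
    have hsub : Finset.Iic (⟨b, hb⟩ : Fin N) ⊆ Finset.univ.filter fun k => v < u (τ k) := by
      intro k hk
      simpa using h.trans_le (hanti (Finset.mem_Iic.1 hk))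
    simpa using Finset.card_le_card hsub
  · intro h
    by_contra hle
    have hsub : (Finset.univ.filter fun k => v < u (τ k)) ⊆ Finset.Iio (⟨b, hb⟩ : Fin N) := by
      intro k hk
      rw [Finset.mem_Iio]
      by_contra hk'
      exact hle ((Finset.mem_filter.1 hk).2.trans_le (hanti (not_lt.1 hk')))
    have := Finset.card_le_card hsub
    simp only [Fin.card_Iio] at this
    omega

lemma measurable_countGT {N : ℕ} (u : Fin N → I) : Measurable (countGT u) :=
  (countGT_anti u).measurable

/-- Given `U = u`, the number of exceedances of an independent uniform variable among the `U`'s,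
truncated below at `1`, has c.d.f. `F^u` after division by `ℓ + 1`. -/
lemma map_countGT_eq_nullLaw {ℓ : ℕ} (u : Fin (ℓ + 1) → I) :
    (volume : Measure I).map (fun v => ((max 1 (countGT u v) : ℕ) : ℝ) / ((ℓ : ℝ) + 1)) =
      nullLaw u := by
  have hm : Measurable fun v : I => ((max 1 (countGT u v) : ℕ) : ℝ) / ((ℓ : ℝ) + 1) :=
    (measurable_from_top (f := fun n : ℕ => ((max 1 n : ℕ) : ℝ) / ((ℓ : ℝ) + 1))).comp
      (measurable_countGT u)
  have := Measure.isProbabilityMeasure_map (μ := (volume : Measure I)) hm.aemeasurable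
  have hl : (0 : ℝ) < (ℓ : ℝ) + 1 := by positivity
  refine Measure.ext_of_Iic _ _ fun x => ?_
  have hcdf : nullLaw u (Set.Iic x) = ENNReal.ofReal (nullCDFFun u x) := by
    rw [nullLaw, (nullCDF u).measure_Iic (nullCDF_tendsto_atBot u), sub_zero]
    rfl
  rw [hcdf, Measure.map_apply hm measurableSet_Iic]
  by_cases h1 : 1 ≤ x
  · have : (fun v : I => ((max 1 (countGT u v) : ℕ) : ℝ) / ((ℓ : ℝ) + 1)) ⁻¹' Set.Iic x =
        Set.univ := by
      refine Set.eq_univ_of_forall fun v => Set.mem_Iic.2 (le_trans ?_ h1)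
      rw [div_le_one hl]
      exact_mod_cast max_le (by omega) (countGT_le u v)
    rw [this, measure_univ, nullCDFFun, if_pos h1, ENNReal.ofReal_one]
  by_cases h2 : 1 / ((ℓ : ℝ) + 1) ≤ x
  · have h0 : 0 ≤ x := le_trans (by positivity) h2
    have hfl : 1 ≤ ⌊x * ((ℓ : ℝ) + 1)⌋₊ := by
      rw [Nat.one_le_floor_iff]
      rwa [div_le_iff₀ hl] at h2
    have hb : ⌊x * ((ℓ : ℝ) + 1)⌋₊ < ℓ + 1 := by
      rw [Nat.floor_lt (by positivity)]
      push_cast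
      push Not at h1
      nlinarith
    have : (fun v : I => ((max 1 (countGT u v) : ℕ) : ℝ) / ((ℓ : ℝ) + 1)) ⁻¹' Set.Iic x =
        Set.Ici (orderStat u (⌊x * ((ℓ : ℝ) + 1)⌋₊ + 1)) := by
      ext v
      rw [Set.mem_preimage, Set.mem_Iic, Set.mem_Ici, div_le_iff₀ hl,
        ← Nat.le_floor_iff (by positivity), ← not_lt (b := orderStat u _), lt_orderStat_iff u hb]
      omega
    rw [this, unitInterval.volume_Ici, nullCDFFun, if_neg h1, if_pos h2]
  · have : (fun v : I => ((max 1 (countGT u v) : ℕ) : ℝ) / ((ℓ : ℝ) + 1)) ⁻¹' Set.Iic x = ∅ := by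
      refine Set.eq_empty_of_forall_notMem fun v hv => h2 (le_trans ?_ (Set.mem_Iic.1 hv))
      have : (1 : ℝ) ≤ (max 1 (countGT u v) : ℕ) := by exact_mod_cast le_max_left 1 _
      exact div_le_div_of_nonneg_right this hl.le
    rw [this, measure_empty, nullCDFFun, if_neg h1, if_neg h2, ENNReal.ofReal_zero]

section

variable {ℓ m : ℕ}

/-- The place of the calibration and null test scores in the family
`(U_1, …, U_{ℓ+1}, V_1, …, V_m)`: the scores being permuted, that is, the test score `i` and the
calibration scores, are the `U`'s, and the null test score `j ≠ i` is `V_j`. -/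
def uniformIndex (H₀ : Finset (Fin m)) (i : {i : Fin m // i ∈ H₀}) :
    Fin ℓ ⊕ {i : Fin m // i ∈ H₀} → Fin (ℓ + 1) ⊕ Fin m :=
  Sum.elim (fun a => Sum.inl a.succ) fun j => if j = i then Sum.inl 0 else Sum.inr j

lemma uniformIndex_injective (H₀ : Finset (Fin m)) (i : {i : Fin m // i ∈ H₀}) :
    Function.Injective (uniformIndex (ℓ := ℓ) H₀ i) := by
  rintro (a | j) (b | k) h
  · simpa [uniformIndex] using h
  · by_cases hk : k = i
    · have h' : (Sum.inl a.succ : Fin (ℓ + 1) ⊕ Fin m) = Sum.inl 0 := h.trans (if_pos hk)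
      exact absurd (Sum.inl.inj h') (Fin.succ_ne_zero a)
    · have h' : (Sum.inl a.succ : Fin (ℓ + 1) ⊕ Fin m) = Sum.inr k := h.trans (if_neg hk)
      exact absurd h' Sum.inl_ne_inr
  · by_cases hj : j = i
    · have h' : (Sum.inl b.succ : Fin (ℓ + 1) ⊕ Fin m) = Sum.inl 0 := h.symm.trans (if_pos hj)
      exact absurd (Sum.inl.inj h') (Fin.succ_ne_zero b)
    · have h' : (Sum.inl b.succ : Fin (ℓ + 1) ⊕ Fin m) = Sum.inr j := h.symm.trans (if_neg hj)
      exact absurd h' Sum.inl_ne_inr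
  · change (if j = i then Sum.inl 0 else Sum.inr (j : Fin m) : Fin (ℓ + 1) ⊕ Fin m) =
      if k = i then Sum.inl 0 else Sum.inr (k : Fin m) at h
    split_ifs at h with hj hk hk
    · rw [hj, hk]
    · exact congrArg Sum.inr (Subtype.ext (Sum.inr.inj h))

lemma uniformIndex_calIndex (H₀ : Finset (Fin m)) (i : {i : Fin m // i ∈ H₀}) (w : Fin (ℓ + 1)) :
    uniformIndex H₀ i (calIndex i w) = Sum.inl w := by
  refine Fin.cases ?_ (fun a => ?_) w
  · simp [uniformIndex, calIndex]
  · simp [uniformIndex, calIndex]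

open Classical in
/-- The coordinate `j` of the smallest p-values, given the `U`'s and `V_j = v`. -/
noncomputable def minPCoord (H₀ : Finset (Fin m)) (i : Fin m) (u : Fin (ℓ + 1) → I) (j : Fin m)
    (v : I) : ℝ :=
  if j = i then 1 / ((ℓ : ℝ) + 1)
  else if j ∈ H₀ then ((max 1 (countGT u v) : ℕ) : ℝ) / ((ℓ : ℝ) + 1)
  else 0

lemma measurable_minPCoord (H₀ : Finset (Fin m)) (i : Fin m) (u : Fin (ℓ + 1) → I) (j : Fin m) :
    Measurable (minPCoord H₀ i u j) := by
  unfold minPCoord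
  split_ifs
  · exact measurable_const
  · exact (measurable_from_top (f := fun n : ℕ => ((max 1 n : ℕ) : ℝ) / ((ℓ : ℝ) + 1))).comp
      (measurable_countGT u)
  · exact measurable_const

lemma map_minPCoord (H₀ : Finset (Fin m)) (i : Fin m) (u : Fin (ℓ + 1) → I) (j : Fin m) :
    (volume : Measure I).map (minPCoord H₀ i u j) = coordLaw H₀ i u j := by
  unfold minPCoord coordLaw
  split_ifs
  · rw [Measure.map_const, measure_univ, one_smul]
  · exact map_countGT_eq_nullLaw u
  · rw [Measure.map_const, measure_univ, one_smul]

lemma minPValue_uniformIndex (H₀ : Finset (Fin m)) (i : {i : Fin m // i ∈ H₀})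
    (x : Fin (ℓ + 1) ⊕ Fin m → I) :
    minPValue H₀ i (orderRel (x ∘ uniformIndex H₀ i)) =
      fun j => minPCoord H₀ i (x ∘ Sum.inl) j (x (Sum.inr j)) := by
  funext j
  by_cases hj : j = i
  · rw [minPValue, if_pos hj, minPCoord, if_pos hj]
  by_cases h : j ∈ H₀
  · rw [minPValue_orderRel H₀ i _ hj h, minPCoord, if_neg hj, if_pos h]
    have h1 : (x ∘ uniformIndex H₀ i) ∘ calIndex i = x ∘ Sum.inl := by
      funext w
      exact congrArg x (uniformIndex_calIndex H₀ i w)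
    have h2 : (x ∘ uniformIndex H₀ i) (Sum.inr ⟨j, h⟩) = x (Sum.inr j) := by
      refine congrArg x ?_
      have : (⟨j, h⟩ : {i : Fin m // i ∈ H₀}) ≠ i := fun e => hj (congrArg Subtype.val e)
      simp [uniformIndex, this]
    rw [h1, h2]
  · rw [minPValue, if_neg hj, dif_neg h, minPCoord, if_neg hj, if_neg h]

lemma measurable_minPValue_uniformIndex (H₀ : Finset (Fin m)) (i : {i : Fin m // i ∈ H₀}) :
    Measurable fun x : Fin (ℓ + 1) ⊕ Fin m → I =>
      minPValue H₀ i (orderRel (x ∘ uniformIndex H₀ i)) :=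
  (measurable_of_finite (minPValue H₀ i)).comp (measurable_orderRel.comp
    (measurable_pi_lambda _ fun _ => measurable_pi_apply _))

/-- The law `𝒟ᵢ` is the law of the smallest p-values when all the scores are i.i.d. uniform. -/
lemma leastFavorable_eq_map (H₀ : Finset (Fin m)) (i : {i : Fin m // i ∈ H₀}) :
    leastFavorable ℓ H₀ i =
      (Measure.pi fun _ : Fin (ℓ + 1) ⊕ Fin m => (volume : Measure I)).map
        fun x => minPValue H₀ i (orderRel (x ∘ uniformIndex H₀ i)) := by
  have hT := measurable_minPValue_uniformIndex (ℓ := ℓ) H₀ i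
  have hmp := measurePreserving_sumPiEquivProdPi_symm
    (fun _ : Fin (ℓ + 1) ⊕ Fin m => (volume : Measure I))
  refine Measure.ext fun A hA => ?_
  rw [← hmp.map_eq, Measure.map_map hT hmp.measurable,
    Measure.map_apply (hT.comp hmp.measurable) hA, Measure.prod_apply ((hT.comp hmp.measurable) hA),
    leastFavorable,
    Measure.bind_apply hA (condLaw ℓ H₀ i).measurable.aemeasurable]
  refine lintegral_congr fun u => ?_
  have hlaw : condLaw ℓ H₀ i u = (Measure.pi fun _ : Fin m => (volume : Measure I)).map
      fun v j => minPCoord H₀ i u j (v j) := by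
    have hprob : ∀ j, IsProbabilityMeasure ((volume : Measure I).map (minPCoord H₀ i u j)) :=
      fun j => Measure.isProbabilityMeasure_map (measurable_minPCoord H₀ i u j).aemeasurable
    rw [Measure.pi_map_pi fun j => (measurable_minPCoord H₀ i u j).aemeasurable]
    simp only [map_minPCoord]
    rfl
  have hmeas : Measurable fun (v : Fin m → I) j => minPCoord H₀ i u j (v j) :=
    measurable_pi_lambda _ fun j =>
      (measurable_minPCoord H₀ i u j).comp (measurable_pi_apply j)
  rw [hlaw, Measure.map_apply hmeas hA]
  congr 1
  ext v
  simp only [Set.mem_preimage, Function.comp_apply, minPValue_uniformIndex]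
  rfl

/-- Integration against the law of a function with values in a finite set requires no
measurability of the integrand. -/
lemma integral_map_of_finite {Ω β E : Type*} [MeasurableSpace Ω] [MeasurableSpace β] [Finite β]
    [DiscreteMeasurableSpace β] [MeasurableSpace E] [MeasurableSingletonClass E] (μ : Measure Ω)
    {r : Ω → β} (hr : Measurable r) (q : β → E) (f : E → ℝ) :
    ∫ y, f y ∂(μ.map fun ω => q (r ω)) = ∫ ω, f (q (r ω)) ∂μ := by
  classical
  have hq : Measurable fun ω => q (r ω) := (measurable_of_finite q).comp hr
  have hfin : (Set.range q).Finite := Set.finite_range q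
  refine integral_map hq.aemeasurable ?_
  refine ⟨(Set.range q).indicator f, ?_, ?_⟩
  · refine (measurable_of_measurable_on_compl_finite _ hfin ?_).stronglyMeasurable
    have : (Set.range q)ᶜ.domRestrict ((Set.range q).indicator f) = fun _ => 0 :=
      funext fun y => Set.indicator_of_notMem y.2 f
    rw [this]
    exact measurable_const
  · have : ∀ᵐ y ∂(μ.map fun ω => q (r ω)), y ∈ Set.range q :=
      (ae_map_iff (p := fun y => y ∈ Set.range q) hq.aemeasurable hfin.measurableSet).2
        (Eventually.of_forall fun ω => Set.mem_range_self _)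
    filter_upwards [this] with y hy
    rw [Set.indicator_of_mem hy]

end

/-! ### The bound for scores with an invariant law -/

section

variable {ℓ m : ℕ}

lemma viaEmbedding_comp {ι κ E : Type*} (e : κ ↪ ι) (τ : Equiv.Perm κ) (s : ι → E) :
    (s ∘ τ.viaEmbedding e) ∘ e = (s ∘ e) ∘ τ := by
  funext k
  simp [Equiv.Perm.viaEmbedding_apply]

lemma swap_viaEmbedding {ι κ : Type*} [DecidableEq ι] [DecidableEq κ] (e : κ ↪ ι) (a b : κ) :
    (Equiv.swap a b).viaEmbedding e = Equiv.swap (e a) (e b) := by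
  ext x
  by_cases hx : x ∈ Set.range e
  · obtain ⟨k, rfl⟩ := hx
    rw [Equiv.Perm.viaEmbedding_apply, e.injective.swap_apply]
  · rw [Equiv.Perm.viaEmbedding_apply_of_notMem _ _ _ hx, Equiv.swap_apply_of_ne_of_ne]
    · exact fun h => hx ⟨a, h.symm⟩
    · exact fun h => hx ⟨b, h.symm⟩

/-- The law of `minPValue` is `𝒟ᵢ`, as far as the expectation of an arbitrary function goes. -/
lemma integral_minPValue_eq (H₀ : Finset (Fin m)) (i : {i : Fin m // i ∈ H₀})
    (ν : Measure (Fin ℓ ⊕ Fin m → ℝ)) [IsProbabilityMeasure ν]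
    (hinv : ∀ τ : Equiv.Perm (Fin ℓ ⊕ {i : Fin m // i ∈ H₀}),
      ν.map (fun s => s ∘ τ.viaEmbedding (nullIndex (Fin ℓ) H₀)) = ν)
    (hinj : ∀ᵐ s ∂ν, Function.Injective s) (f : (Fin m → ℝ) → ℝ) :
    ∫ s, f (minPValue H₀ i (orderRel (s ∘ nullIndex (Fin ℓ) H₀))) ∂ν =
      ∫ p, f p ∂(leastFavorable ℓ H₀ i) := by
  set κ := Fin ℓ ⊕ {i : Fin m // i ∈ H₀}
  have hm : ∀ {ι κ L : Type} [MeasurableSpace L] (e : κ → ι),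
      Measurable fun s : ι → L => s ∘ e := fun e =>
    measurable_pi_lambda _ fun a => measurable_pi_apply (e a)
  have hmf : ∀ {L : Type} [LinearOrder L] [TopologicalSpace L] [OrderClosedTopology L]
      [SecondCountableTopology L] [MeasurableSpace L] [OpensMeasurableSpace L]
      (ξ : Measure (κ → L)),
      AEStronglyMeasurable (fun s => f (minPValue H₀ i (orderRel s))) ξ := fun ξ =>
    ((measurable_of_finite fun r => f (minPValue H₀ i r)).comp
      measurable_orderRel).aestronglyMeasurable
  have hprob := Measure.isProbabilityMeasure_map (μ := ν)
    (hm (nullIndex (Fin ℓ) H₀)).aemeasurable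
  have hiid := map_comp_pi_of_injective (volume : Measure I)
    (uniformIndex_injective (ℓ := ℓ) H₀ i)
  rw [leastFavorable_eq_map, integral_map_of_finite _ (r := fun x => orderRel
    (x ∘ uniformIndex H₀ i)) (measurable_orderRel.comp (hm _)),
    ← integral_map (f := fun s => f (minPValue H₀ i (orderRel s)))
      (hm (uniformIndex H₀ i)).aemeasurable (hmf _), hiid,
    ← integral_map (f := fun s => f (minPValue H₀ i (orderRel s)))
      (hm (nullIndex (Fin ℓ) H₀)).aemeasurable (hmf _)]
  refine integral_comp_orderRel_eq _ _ (fun τ => ?_) ?_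
    (fun τ => map_comp_pi_of_injective _ τ.injective) (ae_injective_pi _)
    fun r => f (minPValue H₀ i r)
  · conv_rhs => rw [← hinv τ]
    rw [Measure.map_map (hm _) (hm _), Measure.map_map (hm _) (hm _)]
    congr 1
    funext s
    exact (viaEmbedding_comp (nullIndex (Fin ℓ) H₀) τ s).symm
  · rw [ae_map_iff (hm _).aemeasurable measurableSet_injective]
    filter_upwards [hinj] with s h
    exact h.comp (nullIndex (Fin ℓ) H₀).injective

open Classical in
/-- The p-values as a function of the order pattern of the scores. -/
noncomputable def patternPValue (r : Fin ℓ ⊕ Fin m → Fin ℓ ⊕ Fin m → Prop) (j : Fin m) : ℝ :=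
  (1 + ∑ a : Fin ℓ, if r (Sum.inr j) (Sum.inl a) then (1 : ℝ) else 0) / (ℓ + 1)

lemma empPValue_eq_patternPValue (s : Fin ℓ ⊕ Fin m → ℝ) :
    empPValue s = patternPValue (orderRel s) := by
  funext j
  simp only [empPValue, patternPValue, orderRel, gt_iff_lt]
  congr

/-- The FDR bound for scores without ties whose law is invariant under the permutations of the
calibration and null test scores. -/
lemma fdr_le_of_map_eq {α : ℝ} (hα : 0 < α) {G : (Fin m → ℝ) → ℝ}
    (hG_pos : ∀ x ∈ Set.Icc (0 : Fin m → ℝ) 1, 0 < G x)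
    (hG_mono : MonotoneOn G (Set.Icc 0 1)) {Ω : Type*} [MeasurableSpace Ω] (μ : Measure Ω)
    [IsProbabilityMeasure μ] (H₀ : Finset (Fin m)) {S : Fin ℓ ⊕ Fin m → Ω → ℝ}
    (hS : ∀ i, Measurable (S i))
    (hinv : ∀ τ : Equiv.Perm (Fin ℓ ⊕ {i : Fin m // i ∈ H₀}),
      μ.map (fun ω x => S (τ.viaEmbedding (nullIndex (Fin ℓ) H₀) x) ω) =
        μ.map (fun ω x => S x ω))
    (hinj : NoTies μ S) :
    fdr μ H₀ (fun ω => adaptiveBH α G (empPValue fun i => S i ω)) ≤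
      α * ∑ i ∈ H₀, ∫ p', 1 / G p' ∂(leastFavorable ℓ H₀ i) := by
  classical
  have hSm : Measurable fun ω x => S x ω := measurable_pi_lambda _ hS
  set ν := μ.map fun ω x => S x ω with hν
  have hprob : IsProbabilityMeasure ν := Measure.isProbabilityMeasure_map hSm.aemeasurable
  have hm : ∀ e : Fin ℓ ⊕ Fin m → Fin ℓ ⊕ Fin m,
      Measurable fun s : Fin ℓ ⊕ Fin m → ℝ => s ∘ e := fun e =>
    measurable_pi_lambda _ fun a => measurable_pi_apply (e a)
  have hinvν : ∀ τ : Equiv.Perm (Fin ℓ ⊕ {i : Fin m // i ∈ H₀}),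
      ν.map (fun s => s ∘ τ.viaEmbedding (nullIndex (Fin ℓ) H₀)) = ν := by
    intro τ
    rw [hν, Measure.map_map (hm _) hSm]
    exact hinv τ
  have hinjν : ∀ᵐ s ∂ν, Function.Injective s := by
    rw [hν, ae_map_iff hSm.aemeasurable measurableSet_injective]
    exact hinj
  -- The contribution of `i`, as a function of the scores.
  set F : Fin m → (Fin ℓ ⊕ Fin m → ℝ) → ℝ :=
    fun i s => fdpTerm i (adaptiveBH α G (empPValue s)) with hF
  have hFrel : ∀ i, F i = fun s => fdpTerm i (adaptiveBH α G (patternPValue (orderRel s))) := by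
    intro i
    funext s
    simp only [hF, empPValue_eq_patternPValue]
  have hFint : ∀ (i : Fin m) (ξ : Measure (Fin ℓ ⊕ Fin m → ℝ)) [IsFiniteMeasure ξ],
      Integrable (F i) ξ := by
    intro i ξ _
    rw [hFrel i]
    exact integrable_comp_orderRel ξ fun r => fdpTerm i (adaptiveBH α G (patternPValue r))
  have hterm : ∀ i : {i : Fin m // i ∈ H₀},
      ∫ s, F i s ∂ν ≤ α * ∫ p', 1 / G p' ∂(leastFavorable ℓ H₀ i) := by
    intro i
    have hl : (0 : ℝ) < (ℓ : ℝ) + 1 := by positivity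
    have hswap : ∀ w : Fin (ℓ + 1), ν.map (swapScore (i : Fin m) w) = ν := by
      intro w
      have := hinvν (Equiv.swap (calIndex i w) (calIndex i 0))
      rw [swap_viaEmbedding, nullIndex_calIndex, nullIndex_calIndex] at this
      exact this
    have hsm : ∀ w : Fin (ℓ + 1), Measurable (swapScore (ℓ := ℓ) (i : Fin m) w) := fun w => hm _
    have hsint : ∀ w, Integrable (fun s => F i (swapScore (i : Fin m) w s)) ν := fun w =>
      (hFint i (ν.map (swapScore (i : Fin m) w))).comp_measurable (hsm w)
    have heq : (ℓ + 1) * ∫ s, F i s ∂ν = ∫ s, ∑ w, F i (swapScore (i : Fin m) w s) ∂ν := by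
      rw [integral_finsetSum _ fun w _ => hsint w]
      have : ∀ w, ∫ s, F i (swapScore (i : Fin m) w s) ∂ν = ∫ s, F i s ∂ν := by
        intro w
        conv_rhs => rw [← hswap w]
        rw [integral_map (hsm w).aemeasurable (hFint i _).aestronglyMeasurable]
      simp [this]
    have hle : ∫ s, ∑ w, F i (swapScore (i : Fin m) w s) ∂ν ≤
        ∫ s, (ℓ + 1) * (α * (1 / G (minPValue H₀ i (orderRel (s ∘ nullIndex (Fin ℓ) H₀))))) ∂ν := by
      refine integral_mono_ae (integrable_finsetSum _ fun w _ => hsint w) ?_ ?_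
      · have hm' : Measurable fun s : Fin ℓ ⊕ Fin m → ℝ => s ∘ nullIndex (Fin ℓ) H₀ :=
          measurable_pi_lambda _ fun a => measurable_pi_apply _
        exact (integrable_comp_orderRel (ν.map fun s => s ∘ nullIndex (Fin ℓ) H₀) fun r =>
          (ℓ + 1) * (α * (1 / G (minPValue H₀ i r)))).comp_measurable hm'
      · filter_upwards [hinjν] with s hs
        exact sum_fdpTerm_swapScore_le hα hG_pos hG_mono H₀ i hs
    rw [← heq, integral_const_mul, integral_const_mul,
      integral_minPValue_eq H₀ i ν hinvν hinjν fun p => 1 / G p] at hle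
    exact le_of_mul_le_mul_left hle hl
  have hfdr : fdr μ H₀ (fun ω => adaptiveBH α G (empPValue fun i => S i ω)) =
      ∑ i ∈ H₀, ∫ s, F i s ∂ν := by
    unfold fdr
    simp only [fdp_eq_sum]
    rw [integral_finsetSum]
    · refine Finset.sum_congr rfl fun i _ => ?_
      rw [hν, integral_map hSm.aemeasurable (hFint i _).aestronglyMeasurable]
    · intro i _
      exact (hFint i ν).comp_measurable hSm
  rw [hfdr, Finset.mul_sum]
  exact Finset.sum_le_sum fun i hi => hterm ⟨i, hi⟩

end

/-! ### Invariance from conditional exchangeability -/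

/-- Conditional exchangeability of `U` given `V` in terms of the joint law of `U` and `V`. -/
lemma CondExchangeable.map_prod_eq {Ω E F ι κ : Type*} [MeasurableSpace Ω] [MeasurableSpace E]
    [MeasurableSpace F] {μ : Measure Ω} [IsProbabilityMeasure μ] {U : ι → Ω → E}
    {V : κ → Ω → F} (h : CondExchangeable μ U V) (hU : ∀ i, Measurable (U i))
    (hV : ∀ j, Measurable (V j)) (τ : Equiv.Perm ι) :
    μ.map (fun ω => ((fun i => U (τ i) ω), fun j => V j ω)) =
      μ.map (fun ω => ((fun i => U i ω), fun j => V j ω)) := by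
  have hUm : ∀ ρ : Equiv.Perm ι, Measurable fun ω i => U (ρ i) ω := fun ρ =>
    measurable_pi_lambda _ fun i => hU (ρ i)
  have hVm : Measurable fun ω j => V j ω := measurable_pi_lambda _ hV
  have key : ∀ (ρ : Equiv.Perm ι) {A : Set (ι → E)} {B : Set (κ → F)}, MeasurableSet A →
      MeasurableSet B →
      ∫ ω in (fun ω j => V j ω) ⁻¹' B, (μ⟦{ω | (fun i => U (ρ i) ω) ∈ A} |
        MeasurableSpace.comap (fun ω j => V j ω) MeasurableSpace.pi⟧) ω ∂μ =
      μ.real ((fun ω i => U (ρ i) ω) ⁻¹' A ∩ (fun ω j => V j ω) ⁻¹' B) := by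
    intro ρ A B hA hB
    have hAm : MeasurableSet {ω | (fun i => U (ρ i) ω) ∈ A} := hUm ρ hA
    rw [setIntegral_condExp hVm.comap_le ((integrable_const (1 : ℝ)).indicator hAm) ⟨B, hB, rfl⟩,
      integral_indicator hAm, Measure.restrict_restrict hAm]
    simp
    rfl
  refine (Measure.ext_prod_iff.2 fun {A B} hA hB => ?_)
  rw [Measure.map_apply ((hUm τ).prodMk hVm) (hA.prod hB),
    Measure.map_apply (f := fun ω => ((fun i => U i ω), fun j => V j ω)) ((hUm 1).prodMk hVm)
      (hA.prod hB)]
  have h1 := key 1 hA hB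
  have h2 := key τ hA hB
  have h3 := setIntegral_congr_ae (μ := μ) (s := (fun ω j => V j ω) ⁻¹' B) (hVm hB)
    ((h τ A hA).mono fun ω hω _ => hω)
  have h4 := h2.symm.trans (h3.symm.trans h1)
  exact (measureReal_eq_measureReal_iff).1 h4

/-- If the calibration and null test variables are exchangeable conditionally on the other ones,
then the law of the whole family is invariant under the permutations of the former. -/
lemma CondExchangeable.map_viaEmbedding_eq {Ω A E : Type*} [MeasurableSpace Ω]
    [MeasurableSpace E] {μ : Measure Ω} [IsProbabilityMeasure μ] {m : ℕ} {H₀ : Finset (Fin m)}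
    {S : A ⊕ Fin m → Ω → E} (hS : ∀ i, Measurable (S i))
    (h : CondExchangeable μ
      (Sum.elim (fun a : A => S (Sum.inl a)) (fun i : {i : Fin m // i ∈ H₀} => S (Sum.inr i)))
      (fun j : {j : Fin m // j ∉ H₀} => S (Sum.inr j)))
    (τ : Equiv.Perm (A ⊕ {i : Fin m // i ∈ H₀})) :
    μ.map (fun ω x => S (τ.viaEmbedding (nullIndex A H₀) x) ω) = μ.map (fun ω x => S x ω) := by
  have hU : ∀ k, Measurable (Sum.elim (fun a : A => S (Sum.inl a))
      (fun i : {i : Fin m // i ∈ H₀} => S (Sum.inr i)) k) := by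
    rintro (a | i)
    · exact hS _
    · exact hS _
  -- The reassembly of the full family from its exchangeable part and its complement.
  let Φ : (A ⊕ {i : Fin m // i ∈ H₀} → E) × ({j : Fin m // j ∉ H₀} → E) → A ⊕ Fin m → E :=
    fun z => Sum.elim (fun a => z.1 (Sum.inl a))
      fun j => if hj : j ∈ H₀ then z.1 (Sum.inr ⟨j, hj⟩) else z.2 ⟨j, hj⟩
  have hΦ : Measurable Φ := by
    refine measurable_pi_lambda _ ?_
    rintro (a | j)
    · exact (measurable_pi_apply _).comp measurable_fst
    · by_cases hj : j ∈ H₀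
      · simp only [Φ, Sum.elim_inr, dif_pos hj]
        exact (measurable_pi_apply _).comp measurable_fst
      · simp only [Φ, Sum.elim_inr, dif_neg hj]
        exact (measurable_pi_apply _).comp measurable_snd
  have hrep : ∀ ρ : Equiv.Perm (A ⊕ {i : Fin m // i ∈ H₀}),
      (fun ω x => S (ρ.viaEmbedding (nullIndex A H₀) x) ω) = Φ ∘ fun ω =>
        ((fun k => Sum.elim (fun a : A => S (Sum.inl a))
          (fun i : {i : Fin m // i ∈ H₀} => S (Sum.inr i)) (ρ k) ω),
          fun j : {j : Fin m // j ∉ H₀} => S (Sum.inr j) ω) := by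
    intro ρ
    have hsplit : ∀ k ω, Sum.elim (fun a : A => S (Sum.inl a))
        (fun i : {i : Fin m // i ∈ H₀} => S (Sum.inr i)) k ω = S (nullIndex A H₀ k) ω := by
      rintro (a | i) ω <;> rfl
    funext ω x
    rcases x with a | j
    · simp only [Φ, Function.comp_apply, Sum.elim_inl, hsplit]
      rw [← Equiv.Perm.viaEmbedding_apply]
      rfl
    · by_cases hj : j ∈ H₀
      · simp only [Φ, Function.comp_apply, Sum.elim_inr, dif_pos hj, hsplit]
        rw [← Equiv.Perm.viaEmbedding_apply]
        rfl
      · simp only [Φ, Function.comp_apply, Sum.elim_inr, dif_neg hj]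
        rw [Equiv.Perm.viaEmbedding_apply_of_notMem]
        rintro ⟨a | i, hi⟩
        · exact Sum.inl_ne_inr hi
        · exact hj (Sum.inr.inj hi ▸ i.2)
  have hmeas : ∀ ρ : Equiv.Perm (A ⊕ {i : Fin m // i ∈ H₀}), Measurable fun ω =>
        ((fun k => Sum.elim (fun a : A => S (Sum.inl a))
          (fun i : {i : Fin m // i ∈ H₀} => S (Sum.inr i)) (ρ k) ω),
          fun j : {j : Fin m // j ∉ H₀} => S (Sum.inr j) ω) := fun ρ =>
    (measurable_pi_lambda _ fun k => hU (ρ k)).prodMk (measurable_pi_lambda _ fun j => hS _)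
  have h1 : (fun ω x => S x ω) = fun ω x =>
      S ((1 : Equiv.Perm (A ⊕ {i : Fin m // i ∈ H₀})).viaEmbedding (nullIndex A H₀) x) ω := by
    have : (1 : Equiv.Perm (A ⊕ {i : Fin m // i ∈ H₀})).viaEmbedding (nullIndex A H₀) = 1 :=
      map_one (Equiv.Perm.viaEmbeddingHom (nullIndex A H₀))
    rw [this]
    rfl
  rw [h1, hrep τ, hrep 1, ← Measure.map_map hΦ (hmeas τ), ← Measure.map_map hΦ (hmeas 1),
    h.map_prod_eq hU (fun j => hS _) τ]
  rfl

/-! ### Exchangeability of the AdaDetect scores -/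

section

variable {𝒵 : Type*} {k ℓ m : ℕ}

/-- The position of the pooled sample in the full sample. -/
def pooledIndex (k : ℕ) {ℓ : ℕ} (T : Type*) : Fin ℓ ⊕ T ↪ Fin (k + ℓ) ⊕ T :=
  (Fin.natAddEmb k).sumMap (Function.Embedding.refl T)

/-- The permutation of the full sample induced by a permutation of the calibration sample and the
null test sample. -/
noncomputable def samplePerm (k : ℕ) (H₀ : Finset (Fin m))
    (τ : Equiv.Perm (Fin ℓ ⊕ {i : Fin m // i ∈ H₀})) : Equiv.Perm (Fin (k + ℓ) ⊕ Fin m) :=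
  (τ.viaEmbedding (pooledIndex k {i : Fin m // i ∈ H₀})).viaEmbedding (nullIndex (Fin (k + ℓ)) H₀)

lemma samplePerm_inl_castAdd (H₀ : Finset (Fin m))
    (τ : Equiv.Perm (Fin ℓ ⊕ {i : Fin m // i ∈ H₀})) (a : Fin k) :
    samplePerm k H₀ τ (Sum.inl (Fin.castAdd ℓ a)) = Sum.inl (Fin.castAdd ℓ a) := by
  change samplePerm k H₀ τ (nullIndex (Fin (k + ℓ)) H₀ (Sum.inl (Fin.castAdd ℓ a))) =
    nullIndex (Fin (k + ℓ)) H₀ (Sum.inl (Fin.castAdd ℓ a))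
  rw [samplePerm, Equiv.Perm.viaEmbedding_apply, Equiv.Perm.viaEmbedding_apply_of_notMem]
  rintro ⟨b | i, hb⟩
  · have h := congrArg Fin.val (Sum.inl.inj hb)
    simp only [Fin.natAddEmb_apply, Fin.val_natAdd, Fin.val_castAdd] at h
    omega
  · exact Sum.inr_ne_inl hb

lemma samplePerm_pooledIndex (H₀ : Finset (Fin m))
    (τ : Equiv.Perm (Fin ℓ ⊕ {i : Fin m // i ∈ H₀})) (x : Fin ℓ ⊕ Fin m) :
    samplePerm k H₀ τ (pooledIndex k (Fin m) x) =
      pooledIndex k (Fin m) (τ.viaEmbedding (nullIndex (Fin ℓ) H₀) x) := by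
  have hsq : ∀ y, pooledIndex k (Fin m) (nullIndex (Fin ℓ) H₀ y) =
      nullIndex (Fin (k + ℓ)) H₀ (pooledIndex k {i : Fin m // i ∈ H₀} y) := by
    rintro (a | i) <;> rfl
  by_cases hx : x ∈ Set.range (nullIndex (Fin ℓ) H₀)
  · obtain ⟨y, rfl⟩ := hx
    rw [hsq, samplePerm, Equiv.Perm.viaEmbedding_apply, Equiv.Perm.viaEmbedding_apply,
      Equiv.Perm.viaEmbedding_apply, hsq]
  · rw [Equiv.Perm.viaEmbedding_apply_of_notMem _ _ _ hx, samplePerm,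
      Equiv.Perm.viaEmbedding_apply_of_notMem]
    rcases x with a | j
    · exact absurd ⟨Sum.inl a, rfl⟩ hx
    · rintro ⟨b | i, hb⟩
      · exact Sum.inl_ne_inr hb
      · exact hx ⟨Sum.inr i, congrArg Sum.inr (Sum.inr.inj hb)⟩

/-- Permuting the calibration and null test observations permutes the scores. -/
lemma adaScore_samplePerm {g : 𝒵 → (Fin k → 𝒵) → (Fin ℓ ⊕ Fin m → 𝒵) → ℝ}
    (hg : ScoreInvariant g) (H₀ : Finset (Fin m))
    (τ : Equiv.Perm (Fin ℓ ⊕ {i : Fin m // i ∈ H₀})) (z : Fin (k + ℓ) ⊕ Fin m → 𝒵)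
    (x : Fin ℓ ⊕ Fin m) :
    adaScore g (fun a => z (samplePerm k H₀ τ (Sum.inl a)))
        (fun j => z (samplePerm k H₀ τ (Sum.inr j))) x =
      adaScore g (fun a => z (Sum.inl a)) (fun j => z (Sum.inr j))
        (τ.viaEmbedding (nullIndex (Fin ℓ) H₀) x) := by
  have hpool : ∀ z' : Fin (k + ℓ) ⊕ Fin m → 𝒵,
      pooled (fun a => z' (Sum.inl a)) (fun j => z' (Sum.inr j)) =
        fun x => z' (pooledIndex k (Fin m) x) := by
    intro z'
    funext x
    rcases x with a | j <;> rfl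
  unfold adaScore
  rw [hpool z, hpool fun x => z (samplePerm k H₀ τ x)]
  simp only [samplePerm_inl_castAdd, samplePerm_pooledIndex]
  exact hg (τ.viaEmbedding (nullIndex (Fin ℓ) H₀)) _ _ fun x => z (pooledIndex k (Fin m) x)

lemma measurable_adaScore [MeasurableSpace 𝒵] {g : 𝒵 → (Fin k → 𝒵) → (Fin ℓ ⊕ Fin m → 𝒵) → ℝ}
    (hg : Measurable fun q : 𝒵 × (Fin k → 𝒵) × (Fin ℓ ⊕ Fin m → 𝒵) => g q.1 q.2.1 q.2.2)
    (x : Fin ℓ ⊕ Fin m) : Measurable fun z : Fin (k + ℓ) ⊕ Fin m → 𝒵 =>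
      adaScore g (fun a => z (Sum.inl a)) (fun j => z (Sum.inr j)) x := by
  have hpool : ∀ x : Fin ℓ ⊕ Fin m, Measurable fun z : Fin (k + ℓ) ⊕ Fin m → 𝒵 =>
      pooled (fun a => z (Sum.inl a)) (fun j => z (Sum.inr j)) x := by
    rintro (a | j) <;> exact measurable_pi_apply _
  exact hg.comp ((hpool x).prodMk ((measurable_pi_lambda _ fun a => measurable_pi_apply _).prodMk
    (measurable_pi_lambda _ hpool)))

lemma map_adaScore_eq {Ω : Type*} [MeasurableSpace Ω] [MeasurableSpace 𝒵] {μ : Measure Ω}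
    [IsProbabilityMeasure μ] {H₀ : Finset (Fin m)} {Y : Fin (k + ℓ) → Ω → 𝒵}
    {X : Fin m → Ω → 𝒵} {g : 𝒵 → (Fin k → 𝒵) → (Fin ℓ ⊕ Fin m → 𝒵) → ℝ}
    (hY : ∀ i, Measurable (Y i)) (hX : ∀ i, Measurable (X i))
    (hg : Measurable fun q : 𝒵 × (Fin k → 𝒵) × (Fin ℓ ⊕ Fin m → 𝒵) => g q.1 q.2.1 q.2.2)
    (hinv : ScoreInvariant g) (hexch : DataExchangeable μ H₀ Y X)
    (τ : Equiv.Perm (Fin ℓ ⊕ {i : Fin m // i ∈ H₀})) :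
    μ.map (fun ω x => adaScore g (fun a => Y a ω) (fun j => X j ω)
        (τ.viaEmbedding (nullIndex (Fin ℓ) H₀) x)) =
      μ.map (fun ω x => adaScore g (fun a => Y a ω) (fun j => X j ω) x) := by
  set Z : Fin (k + ℓ) ⊕ Fin m → Ω → 𝒵 := Sum.elim Y X
  have hZ : ∀ x, Measurable (Z x) := by
    rintro (a | j)
    · exact hY a
    · exact hX j
  have hlaw := CondExchangeable.map_viaEmbedding_eq (S := Z) (H₀ := H₀) hZ hexch
    (τ.viaEmbedding (pooledIndex k {i : Fin m // i ∈ H₀}))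
  have hscore := measurable_pi_lambda _ (measurable_adaScore hg)
  have h := congrArg (Measure.map fun (z : Fin (k + ℓ) ⊕ Fin m → 𝒵) (x : Fin ℓ ⊕ Fin m) =>
    adaScore g (fun a => z (Sum.inl a)) (fun j => z (Sum.inr j)) x) hlaw
  rw [Measure.map_map hscore (measurable_pi_lambda _ fun x => hZ _),
    Measure.map_map hscore (measurable_pi_lambda _ hZ)] at h
  refine Eq.trans ?_ h
  congr 1
  funext ω x
  exact (adaScore_samplePerm hinv H₀ τ (fun x => Z x ω) x).symm

end

end AdaDetect

theorem theorem3p4 {ℓ m : ℕ} {α : ℝ} (hα : 0 < α) (G : (Fin m → ℝ) → ℝ)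
    (hG_pos : ∀ x ∈ Set.Icc (0 : Fin m → ℝ) 1, 0 < G x)
    (hG_mono : MonotoneOn G (Set.Icc 0 1))
    {Ω : Type*} [MeasurableSpace Ω] (μ : Measure Ω) [IsProbabilityMeasure μ] :
    -- arbitrary exchangeable scores without ties
    (∀ (H₀ : Finset (Fin m)) (S : Fin ℓ ⊕ Fin m → Ω → ℝ), (∀ i, Measurable (S i)) →
      AdaDetect.ScoresExchangeable μ H₀ S → AdaDetect.NoTies μ S →
      AdaDetect.fdr μ H₀
          (fun ω => AdaDetect.adaptiveBH α G (AdaDetect.empPValue fun i => S i ω)) ≤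
        α * ∑ i ∈ H₀, ∫ p', 1 / G p' ∂(AdaDetect.leastFavorable ℓ H₀ i)) ∧
    -- AdaDetect scores
    (∀ {𝒵 : Type*} [MeasurableSpace 𝒵] (k : ℕ) (P₀ : Measure 𝒵)
      (Y : Fin (k + ℓ) → Ω → 𝒵) (X : Fin m → Ω → 𝒵)
      (g : 𝒵 → (Fin k → 𝒵) → (Fin ℓ ⊕ Fin m → 𝒵) → ℝ),
      (∀ i, Measurable (Y i)) → (∀ i, Measurable (X i)) → (∀ i, μ.map (Y i) = P₀) →
      Measurable (fun q : 𝒵 × (Fin k → 𝒵) × (Fin ℓ ⊕ Fin m → 𝒵) => g q.1 q.2.1 q.2.2) →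
      AdaDetect.ScoreInvariant g →
      AdaDetect.DataExchangeable μ (AdaDetect.nulls μ P₀ X) Y X →
      AdaDetect.NoTies μ
        (fun i ω => AdaDetect.adaScore g (fun a => Y a ω) (fun j => X j ω) i) →
      AdaDetect.fdr μ (AdaDetect.nulls μ P₀ X)
          (fun ω => AdaDetect.adaptiveBH α G
            (AdaDetect.empPValue (AdaDetect.adaScore g (fun a => Y a ω) (fun j => X j ω)))) ≤
        α * ∑ i ∈ AdaDetect.nulls μ P₀ X,
          ∫ p', 1 / G p' ∂(AdaDetect.leastFavorable ℓ (AdaDetect.nulls μ P₀ X) i)) := by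
  refine ⟨fun H₀ S hS hexch hties => ?_, fun k P₀ Y X g hY hX _ hg hinv hexch hties => ?_⟩
  · exact AdaDetect.fdr_le_of_map_eq hα hG_pos hG_mono μ H₀ hS
      (AdaDetect.CondExchangeable.map_viaEmbedding_eq hS hexch) hties
  · refine AdaDetect.fdr_le_of_map_eq hα hG_pos hG_mono μ (AdaDetect.nulls μ P₀ X) (fun x => ?_)
      (AdaDetect.map_adaScore_eq hY hX hg hinv hexch) hties
    have hZ : Measurable fun (ω : Ω) x => Sum.elim (fun a => Y a ω) (fun j => X j ω) x :=
      measurable_pi_lambda _ (by rintro (a | j); exacts [hY a, hX j])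
    exact (AdaDetect.measurable_adaScore hg x).comp hZ
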